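/- **Setting.** Robots $i\in\mathcal V=\{1,\dots,N\}$ have state spaces $X_i\subseteq\mathbb R^d$, control sets $U_i\subseteq\mathbb R^{m_i}$ and dynamics $\dot x_i=f_i(x_i,u_i)$. Let $X_i^O\subseteq X_i$ be the obstacle regions, $X_i^G\subseteq X_i\setminus X_i^O$ the closed goal regions, and $\sigma>0$ the safety distance. All norms are Euclidean, and distances to the empty set are $+\infty$. Put $X_i^F=\{x_i\in X_i\setminus X_i^O:\ \|x_i-x_j\|\ge\sigma\ \ \forall j\ne i,\ \forall x_j\in X_j^G\}$, $\mathbf X=\prod_iX_i$, $\mathbf X^G=\prod_iX^G_i$ and $\mathbf S=\{x\in\prod_iX_i^F:\ \|x_i-x_j\|\ge\sigma,\ i\neq j\}$. Assume that $\mathbf S$ is closed and that $\|x_i-x_j\|\ge\sigma$ for $x\in\mathbf X^G$, $i\ne j$. Let $F_i(x_i)=f_i(x_i,U_i)$. For each $i$ assume: $X_i,U_i$ are non-empty and compact; $f_i$ is continuous on $X_i\times U_i$; $\|f_i(x_i,u_i)\|\le c_i(\|x_i\|+\|u_i\|+1)$ there for some $c_i\ge0$; $F_i(x_i)$ is convex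 for $x_i\in X_i$; $F_i$ is Lipschitz on $X_i$ for the Hausdorff distance with constant $l_i\geq 0$. Assume also that there is $\rho>0$ with $\|x_i-x_j\|>\sigma+\rho$ for all $i\ne j$, $x_i\in X_i^G$, $x_j\in X_j^F$. Put $M_i=\max_{X_i\times U_i}\|f_i\|$, $M^+=(\sum_iM_i^2)^{1/2}$, $l^+=(\sum_il_i^2)^{1/2}$. **Minimal arrival times.** A policy is an arbitrary map $\pi=(\pi_i)_i$ with $\pi_i:\mathbf X\to U_i$. An execution of $\pi$ from $x$ with arrival vector $t\in[0,\infty]^N$ is a locally absolutely continuous $y:[0,\infty)\to(\mathbb R^d)^N$ with $y(0)=x$ such that, for each $i$, $\dot y_i(s)=f_i(y_i(s),\pi_i(y(s)))$ for a.e. $s<t_i$; $y_i(s)\notin X_i^G$ for $s<t_i$; if $t_i<\infty$, then $y_i(t_i)\in X_i^G$ and $y_i(s)=y_i(t_i)$ for $s\ge t_i$; and $y(s)\in\mathbf S$ for all finite $s\in[0,\max_jt_j]$. So $t_i$ is the first arrival time of robot $i$, which rests in its goal region afterwards. Let $\vartheta(x,\pi)$ be the set of arrival vectors of the executions of $\pi$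 from $x$, or $\{(+\infty,\dots,+\infty)\}$ if there is no execution. With the componentwise order $\preceq$, the Pareto frontier of $A\subseteq[0,\infty]^N$ is $\mathcal E(A)=\{t\in A:\ \nexists t'\in A,\ t'\ne t,\ t'\preceq t\}$. Define $\varTheta^*(x)=\mathcal E(\bigcup_\pi\vartheta(x,\pi))$. For a map $\varTheta$ with values subsets of $[0,\infty]^N$, the epigraphical profile is $E_\varTheta(x)=\{t\in\mathbb R^N:\ \exists t'\in\varTheta(x),\ t'\preceq t\}$. **Discretization.** For $p=1,2,\dots$ let $X_i^p\subseteq X_i$ be finite, $\mathbf X^p=\prod_iX_i^p$, and $h_p,\varepsilon_p$ real with $\varepsilon_p>2h_p>0$, $\varepsilon_p\to0$, $h_p/\varepsilon_p\to0$, such that every point of $\mathbf X$ is within distance $h_p$ of $\mathbf X^p$. Put $\mathbf S^p=\{x\in\mathbf X^p: d(x,\mathbf S)\le h_p\}$ and $\alpha_p=2h_p+\varepsilon_ph_pl^++\varepsilon_p^2l^+M^+$. If $d(x_i,X_i^G)>M_i\varepsilon_p+h_p$, let $\tilde X_i^p(x_i)=\{y\in X_i:\ d(y,x_i+\varepsilon_pF_i(x_i))\le\alpha_p\}$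 and $\tilde T_i^p(x_i)=[\varepsilon_p-2h_p,\varepsilon_p+2h_p]$; otherwise let $\tilde X_i^p(x_i)=\{x_i\}$ and $\tilde T^p_i(x_i)=\{0\}$. Put $\tilde X^p(x)=\mathbf S^p\cap\prod_i\tilde X_i^p(x_i)$ and $\tilde T^p(x)=(h_p\mathbb Z_{\geq0})^N\cap\prod_i\tilde T_i^p(x_i)$. The Bellman operator is $$(\mathbb T\varTheta)(x)=\mathcal E\big(\{\tilde t+t:\ \tilde t\in\tilde T^p(x),\ \tilde x\in\tilde X^p(x),\ t\in\varTheta(\tilde x)\}\big),$$ read as $\{(+\infty,\dots,+\infty)\}$ when the set in braces is empty. Let $\varTheta^p_0(x)=\{0\}$ for $x\in\mathbf S^p$, $\varTheta^p_0(x)=\{(+\infty,\dots,+\infty)\}$ for $x\in\mathbf X^p\setminus\mathbf S^p$, and $\varTheta^p_{n+1}=\mathbb T\varTheta^p_n$. For sets $A_n\subseteq\mathbb R^N$, $\mathrm{Lim}_nA_n=L$ means that $L=\{t:\lim_nd(t,A_n)=0\}=\{t:\liminf_nd(t,A_n)=0\}$. **Claim.** (1) For every $p$ there is a map $\varTheta^p_\infty$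 on $\mathbf X^p$, with values subsets of $[0,\infty]^N$, such that $\mathbb T\varTheta^p_\infty=\varTheta^p_\infty$ and $E_{\varTheta^p_\infty}(x)=\mathrm{Lim}_{n\to\infty}E_{\varTheta^p_n}(x)$ for all $x\in\mathbf X^p$. (2) For all such $\varTheta^p_\infty$, all $\eta_p\ge h_p$ with $\eta_p\to0$, and every $x\in\mathbf X$, $$E_{\varTheta^*}(x)=\operatorname*{Lim}_{p\to\infty}\ \bigcup_{\tilde x\in\mathbf X^p,\ \|\tilde x-x\|\le\eta_p}E_{\varTheta^p_\infty}(\tilde x).$$ -/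

import Mathlib

open Set Filter Topology MeasureTheory
open scoped ENNReal

noncomputable section

/-! ### Kuratowski limits and Pareto frontiers -/

/-- Kuratowski lower limit: the points `x` with `lim d(x, A n) = 0`. The distance is
`[0,∞]`-valued, so the distance to the empty set is `∞`. -/
def kuratowskiLiminf {α : Type*} [PseudoEMetricSpace α] (A : ℕ → Set α) : Set α :=
  {x | Tendsto (fun n => Metric.infEDist x (A n)) atTop (𝓝 0)}

/-- Kuratowski upper limit: the points `x` with `liminf d(x, A n) = 0`. -/
def kuratowskiLimsup {α : Type*} [PseudoEMetricSpace α] (A : ℕ → Set α) : Set α :=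
  {x | liminf (fun n => Metric.infEDist x (A n)) atTop = 0}

/-- `L` is the Kuratowski limit of the sets `A n`. -/
def IsKuratowskiLimit {α : Type*} [PseudoEMetricSpace α] (A : ℕ → Set α) (L : Set α) : Prop :=
  kuratowskiLiminf A = L ∧ kuratowskiLimsup A = L

/-- Vectors of travelling times of `N` robots, with values in `[0,∞]`, ordered componentwise. -/
abbrev TimeVec (N : ℕ) : Type := Fin N → ℝ≥0∞

/-- The Pareto frontier of a set of time vectors. -/
def paretoFrontier {N : ℕ} (A : Set (TimeVec N)) : Set (TimeVec N) :=
  {t | t ∈ A ∧ ¬ ∃ t' ∈ A, t' ≠ t ∧ t' ≤ t}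

/-- The state of one robot. -/
abbrev RState (d : ℕ) : Type := EuclideanSpace ℝ (Fin d)

/-- The joint state of `N` robots, with the Euclidean norm of `ℝ^(N d)`. -/
abbrev JState (N d : ℕ) : Type := PiLp 2 (fun _ : Fin N => RState d)

/-- Epigraphical profile `Θ(x) + ℝ_{≥0}^N`, as a subset of `ℝ^N`: vectors of `Θ(x)` with an
infinite component contribute nothing. -/
def epiProfile {N d : ℕ} (Θ : JState N d → Set (TimeVec N)) (x : JState N d) :
    Set (EuclideanSpace ℝ (Fin N)) :=
  {t | ∃ t' ∈ Θ x, ∀ i, t' i ≠ ∞ ∧ (t' i).toReal ≤ t i}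

/-! ### The team of robots -/

/-- Data of the motion planning problem: for each robot the state space `X i`, the set `U i` of
control values, the dynamics `f i`, the obstacle region `XO i` and the goal region `XG i`, and the
safety distance `σ`. -/
structure RobotTeam (N d : ℕ) where
  m : Fin N → ℕ
  X : Fin N → Set (RState d)
  U : (i : Fin N) → Set (EuclideanSpace ℝ (Fin (m i)))
  f : (i : Fin N) → RState d → EuclideanSpace ℝ (Fin (m i)) → RState d
  XO : Fin N → Set (RState d)
  XG : Fin N → Set (RState d)
  σ : ℝ

namespace RobotTeam

variable {N d : ℕ} (R : RobotTeam N d)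

/-- The velocity sets `F_i(x_i) = {f_i(x_i, u_i) | u_i ∈ U_i}`. -/
def F (i : Fin N) (x : RState d) : Set (RState d) := R.f i x '' R.U i

/-- The free region of robot `i`. -/
def XF (i : Fin N) : Set (RState d) :=
  {x | x ∈ R.X i \ R.XO i ∧ ∀ j, j ≠ i → ∀ y ∈ R.XG j, R.σ ≤ ‖x - y‖}

/-- The joint state space. -/
def joint : Set (JState N d) := {x | ∀ i, x i ∈ R.X i}

/-- The joint goal region. -/
def jointGoal : Set (JState N d) := {x | ∀ i, x i ∈ R.XG i}

/-- The safety region `S`. -/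
def safe : Set (JState N d) :=
  {x | (∀ i, x i ∈ R.XF i) ∧ ∀ i j, i ≠ j → R.σ ≤ ‖x i - x j‖}

/-- The maximal speed `M_i` of robot `i`. -/
def M (i : Fin N) : ℝ := sSup {r | ∃ x ∈ R.X i, ∃ u ∈ R.U i, r = ‖R.f i x u‖}

/-- `M⁺`. -/
def Mplus : ℝ := Real.sqrt (∑ i, R.M i ^ 2)

/-- The standing requirements of the problem formulation. -/
structure WellPosed : Prop where
  obstacle_subset : ∀ i, R.XO i ⊆ R.X i
  goal_subset : ∀ i, R.XG i ⊆ R.X i \ R.XO i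
  goal_closed : ∀ i, IsClosed (R.XG i)
  safe_closed : IsClosed R.safe
  sigma_pos : 0 < R.σ
  goal_separated : ∀ x ∈ R.jointGoal, ∀ i j, i ≠ j → R.σ ≤ ‖x i - x j‖

/-- Compactness, continuity, linear growth, convexity and Lipschitz continuity (`l i` is a
Lipschitz constant of `F_i` for the Hausdorff distance) of the dynamics. -/
structure Regular (l : Fin N → ℝ) : Prop where
  X_nonempty : ∀ i, (R.X i).Nonempty
  X_compact : ∀ i, IsCompact (R.X i)
  U_nonempty : ∀ i, (R.U i).Nonempty
  U_compact : ∀ i, IsCompact (R.U i)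
  f_continuous : ∀ i, ContinuousOn (fun q : RState d × EuclideanSpace ℝ (Fin (R.m i)) =>
    R.f i q.1 q.2) (R.X i ×ˢ R.U i)
  f_linear_growth : ∀ i, ∃ c : ℝ, 0 ≤ c ∧ ∀ x ∈ R.X i, ∀ u ∈ R.U i,
    ‖R.f i x u‖ ≤ c * (‖x‖ + ‖u‖ + 1)
  F_convex : ∀ i, ∀ x ∈ R.X i, Convex ℝ (R.F i x)
  l_nonneg : ∀ i, 0 ≤ l i
  F_lipschitz : ∀ i, ∀ x ∈ R.X i, ∀ y ∈ R.X i, ∀ v ∈ R.F i x, ∃ w ∈ R.F i y,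
    ‖v - w‖ ≤ l i * ‖x - y‖

/-- The free region of each robot keeps a distance larger than `σ`, with a uniform margin, from the
goal regions of the other robots. -/
def GoalsClear : Prop :=
  ∃ ρ : ℝ, 0 < ρ ∧ ∀ i j, i ≠ j → ∀ x ∈ R.XG i, ∀ y ∈ R.XF j, R.σ + ρ < ‖x - y‖

/-! ### Minimal arrival times -/

/-- State feedback policies: arbitrary maps from joint states to control values. -/
def IsPolicy (π : (i : Fin N) → JState N d → EuclideanSpace ℝ (Fin (R.m i))) : Prop :=
  ∀ i, ∀ x ∈ R.joint, π i x ∈ R.U i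

/-- `y` is a collision-free execution of the policy `π` from the state `x`, with vector `t` of
first arrival times: robot `i` follows its closed-loop dynamics until the first time `t i` at which
it is in its goal region (`t i = ∞` if there is none) and rests there from then on; the team is in
the safety region until the last robot has arrived. -/
structure IsExecution (π : (i : Fin N) → JState N d → EuclideanSpace ℝ (Fin (R.m i)))
    (x : JState N d) (y : ℝ → JState N d) (t : TimeVec N) : Prop where
  start : y 0 = x
  abs_cont : ∀ i, ∀ b : ℝ, 0 ≤ b → AbsolutelyContinuousOnInterval (fun s => y s i) 0 b
  dynamics : ∀ i, ∀ᵐ s : ℝ, 0 < s → ENNReal.ofReal s < t i →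
    HasDerivAt (fun r => y r i) (R.f i (y s i) (π i (y s))) s
  not_before : ∀ i, ∀ s : ℝ, 0 ≤ s → ENNReal.ofReal s < t i → y s i ∉ R.XG i
  arrival : ∀ i, t i ≠ ∞ → y (t i).toReal i ∈ R.XG i
  rest : ∀ i, ∀ s : ℝ, 0 ≤ s → t i ≤ ENNReal.ofReal s → y s i = y (t i).toReal i
  safety : ∀ i, ∀ s : ℝ, 0 ≤ s → ENNReal.ofReal s ≤ t i → y s ∈ R.safe

/-- The arrival time vectors induced by the policy `π` from the state `x`; the vector is infinite
if the policy has no collision-free execution. -/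
def arrivalTimes (π : (i : Fin N) → JState N d → EuclideanSpace ℝ (Fin (R.m i)))
    (x : JState N d) : Set (TimeVec N) :=
  {t | (∃ y, R.IsExecution π x y t) ∨ ((¬ ∃ y t', R.IsExecution π x y t') ∧ t = ⊤)}

/-- The minimal arrival time function `Θ*`: the Pareto optimal arrival time vectors over all
policies. -/
def minArrival (x : JState N d) : Set (TimeVec N) :=
  paretoFrontier {t | ∃ π, R.IsPolicy π ∧ t ∈ R.arrivalTimes π x}

end RobotTeam

/-! ### The discretization -/

/-- Data of the discretization: for each index `p` the grids of the single robots, the spatial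
resolution `h p` and the temporal resolution `ε p`. The first grid has index `0`. -/
structure Discretization (N d : ℕ) where
  grid : ℕ → Fin N → Set (RState d)
  h : ℕ → ℝ
  ε : ℕ → ℝ

namespace Discretization

variable {N d : ℕ} (D : Discretization N d) (R : RobotTeam N d) (l : Fin N → ℝ) (p : ℕ)

/-- The grid of joint states. -/
def jointGrid : Set (JState N d) := {x | ∀ i, x i ∈ D.grid p i}

/-- Finite grids of resolution `h p` in the joint state space, `ε p > 2 h p > 0`, `ε p → 0` and
`h p / ε p → 0`. -/
structure Admissible : Prop where
  grid_subset : ∀ p i, D.grid p i ⊆ R.X i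
  grid_finite : ∀ p i, (D.grid p i).Finite
  resolution : ∀ p, ∀ x ∈ R.joint, ∃ x' ∈ D.jointGrid p, ‖x - x'‖ ≤ D.h p
  h_pos : ∀ p, 0 < D.h p
  two_h_lt : ∀ p, 2 * D.h p < D.ε p
  eps_tendsto : Tendsto D.ε atTop (𝓝 0)
  ratio_tendsto : Tendsto (fun p => D.h p / D.ε p) atTop (𝓝 0)

/-- The discrete safety region `S^p = (S + h_p B) ∩ X^p`. -/
def safeGrid : Set (JState N d) :=
  {x | x ∈ D.jointGrid p ∧ Metric.infEDist x R.safe ≤ ENNReal.ofReal (D.h p)}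

/-- `α_p = 2 h_p + ε_p h_p l⁺ + ε_p² l⁺ M⁺`. -/
def α : ℝ :=
  2 * D.h p + D.ε p * D.h p * Real.sqrt (∑ i, l i ^ 2)
    + D.ε p ^ 2 * Real.sqrt (∑ i, l i ^ 2) * R.Mplus

/-- Robot `i` is still under way at `x`: `d(x, X_i^G) > M_i ε_p + h_p`. -/
def UnderWay (i : Fin N) (x : RState d) : Prop :=
  ENNReal.ofReal (R.M i * D.ε p + D.h p) < Metric.infEDist x (R.XG i)

open Classical in
/-- The successors of robot `i`: `(x + ε_p F_i(x) + α_p B) ∩ X_i`, or `{x}` close to the goal. -/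
def stepX (i : Fin N) (x : RState d) : Set (RState d) :=
  if D.UnderWay R p i x then
    {y | y ∈ R.X i ∧
      Metric.infEDist y ((fun v => x + D.ε p • v) '' R.F i x) ≤ ENNReal.ofReal (D.α R l p)}
  else {x}

open Classical in
/-- The time steps of robot `i`: `[ε_p - 2 h_p, ε_p + 2 h_p]`, or `{0}` close to the goal. -/
def stepT (i : Fin N) (x : RState d) : Set ℝ :=
  if D.UnderWay R p i x then Icc (D.ε p - 2 * D.h p) (D.ε p + 2 * D.h p) else {0}

/-- The successors of a joint state on the discrete safety region. -/
def succX (x : JState N d) : Set (JState N d) :=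
  {y | y ∈ D.safeGrid R p ∧ ∀ i, y i ∈ D.stepX R l p i (x i)}

/-- The joint time steps, on the lattice of mesh `h_p`. -/
def succT (x : JState N d) : Set (Fin N → ℝ) :=
  {τ | ∀ i, τ i ∈ D.stepT R p i (x i) ∧ ∃ k : ℕ, τ i = k * D.h p}

/-- The candidates `τ + t` in the Bellman operator. -/
def candidates (Θ : JState N d → Set (TimeVec N)) (x : JState N d) : Set (TimeVec N) :=
  {t | ∃ τ ∈ D.succT R p x, ∃ y ∈ D.succX R l p x, ∃ t' ∈ Θ y,
    t = fun i => ENNReal.ofReal (τ i) + t' i}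

open Classical in
/-- The Bellman operator in the Pareto sense; the value is infinite where there is no candidate. -/
def bellman (Θ : JState N d → Set (TimeVec N)) (x : JState N d) : Set (TimeVec N) :=
  if (D.candidates R l p Θ x).Nonempty then paretoFrontier (D.candidates R l p Θ x) else {⊤}

open Classical in
/-- The value iterates `Θ^p_n`. -/
def iter : ℕ → JState N d → Set (TimeVec N)
  | 0 => fun x => if x ∈ D.safeGrid R p then {0} else {⊤}
  | n + 1 => D.bellman R l p (iter n)

/-- `Θ` is the limit `Θ^p_∞` of the value iteration on the grid with index `p`: a fixed point of
the Bellman operator whose epigraphical profiles are the Kuratowski limits of those of the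
iterates. -/
structure IsValueLimit (Θ : JState N d → Set (TimeVec N)) : Prop where
  fixed : ∀ x ∈ D.jointGrid p, D.bellman R l p Θ x = Θ x
  limit : ∀ x ∈ D.jointGrid p,
    IsKuratowskiLimit (fun n => epiProfile (D.iter R l p n) x) (epiProfile Θ x)

end Discretization

end

/-! ### Averages of derivatives -/

/-! Everything is reduced to arcs of the differential inclusion y_i' ∈ F_i(y_i), written through
increments: y(s') − y(s) lies within l M (s' − s)² of (s' − s) F(y(s)). This form needs no
derivatives, survives pointwise limits and admits an error parameter, so exact trajectories and grid
paths are handled by one notion. `reachTimes` collects the times by which the team can have arrived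
along safe joint arcs.

Continuous side (`mem_epiProfile_minArrival`): the profile of Θ* is the upward closure of
`reachTimes`. Finite arrival vectors of policies come from arcs. Conversely, `reachTimes` is closed,
so each of its vectors dominates a minimal one. An arc with minimal times enters no goal early (the
robot could stop there) and visits no joint state twice while a robot is under way (the loop could
be cut out). Its velocities are therefore a function of the joint state, that is, a policy; since
policies are arbitrary maps, no regularity is required of it.

Discrete side: for Pareto frontiers only the shortest admissible time step `minStep` matters, so the
value iterates are frontiers of `minStep` times sets of integer vectors. These sets decrease under
iteration from index 1 on. Their intersection is a fixed point because the grid is finite, and it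
describes infinite grid paths with finite budgets of moves. Every value limit has the same profile,
since a Kuratowski limit is determined by its sequence.

The two sides meet through compactness and shadowing. Grid paths are arcs up to `pathError`, which
tends to 0; ultrafilter limits of them are arcs, which bounds the upper limit
(`exists_reachTimes_of_limit`). Conversely, sampling an arc at multiples of ε and rounding to the
grid gives a grid path (`exists_mem_limitCounts_of_isTeamArc`): α covers the errors, and the
clearance of the goals lets robots stop slightly early without violating safety. -/

theorem AbsolutelyContinuousOnInterval.clm_comp {E : Type*} [NormedAddCommGroup E]
    [NormedSpace ℝ E] {g : ℝ → E} {a b : ℝ} (hg : AbsolutelyContinuousOnInterval g a b)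
    (φ : StrongDual ℝ E) : AbsolutelyContinuousOnInterval (fun s => φ (g s)) a b := by
  refine squeeze_zero (fun t => Finset.sum_nonneg fun i _ => dist_nonneg) (fun t => ?_)
    (by simpa using Tendsto.const_mul ‖φ‖ hg)
  rw [Finset.mul_sum]
  gcongr with i
  rw [dist_eq_norm, dist_eq_norm, ← map_sub]
  exact φ.le_opNorm _

/-- The mean slope of an absolutely continuous curve lies in every closed convex set that contains
almost all of its derivatives. -/
theorem AbsolutelyContinuousOnInterval.slope_mem_of_ae_deriv_mem {E : Type*}
    [NormedAddCommGroup E] [NormedSpace ℝ E] {g : ℝ → E} {a b : ℝ} (hab : a < b)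
    (hg : AbsolutelyContinuousOnInterval g a b) {C : Set E} (hC : Convex ℝ C) (hC' : IsClosed C)
    (h : ∀ᵐ s : ℝ, s ∈ Ioo a b → ∃ v ∈ C, HasDerivAt g v s) :
    (b - a)⁻¹ • (g b - g a) ∈ C := by
  by_contra hn
  -- A separating functional reduces the claim to a real-valued function, where the integral of the
  -- derivative recovers the increment.
  obtain ⟨φ, u, h1, h2⟩ := geometric_hahn_banach_closed_point hC hC' hn
  have hac := hg.clm_comp φ
  have hint := hac.integral_deriv_eq_sub
  have hle : ∫ s in a..b, deriv (fun s => φ (g s)) s ≤ ∫ _ in a..b, u := by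
    refine intervalIntegral.integral_mono_ae_restrict hab.le hac.intervalIntegrable_deriv
      (by simp) ?_
    have h3 : ∀ᵐ s : ℝ, s ≠ a := by simp [ae_iff, measure_singleton]
    have h4 : ∀ᵐ s : ℝ, s ≠ b := by simp [ae_iff, measure_singleton]
    rw [EventuallyLE, ae_restrict_iff' measurableSet_Icc]
    filter_upwards [h, h3, h4] with s hs hsa hsb hmem
    obtain ⟨v, hv, hd⟩ := hs ⟨lt_of_le_of_ne hmem.1 hsa.symm, lt_of_le_of_ne hmem.2 hsb⟩
    have : HasDerivAt (fun s => φ (g s)) (φ v) s := φ.hasFDerivAt.comp_hasDerivAt s hd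
    rw [this.deriv]
    exact (h1 v hv).le
  rw [hint, intervalIntegral.integral_const, smul_eq_mul] at hle
  rw [map_smul, map_sub, smul_eq_mul] at h2
  have hpos : 0 < b - a := sub_pos.2 hab
  rw [inv_mul_eq_div, lt_div_iff₀ hpos] at h2
  linarith

/-! ### Bounds for the dynamics -/

namespace RobotTeam

variable {N d : ℕ} {R : RobotTeam N d} {l : Fin N → ℝ}

theorem Regular.norm_f_le_M (hreg : R.Regular l) {i : Fin N} {x : RState d} (hx : x ∈ R.X i)
    {u : EuclideanSpace ℝ (Fin (R.m i))} (hu : u ∈ R.U i) : ‖R.f i x u‖ ≤ R.M i := by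
  refine le_csSup ?_ ⟨x, hx, u, hu, rfl⟩
  have hc := ((hreg.X_compact i).prod (hreg.U_compact i)).bddAbove_image
    (hreg.f_continuous i).norm
  refine hc.mono ?_
  rintro r ⟨x, hx, u, hu, rfl⟩
  exact ⟨(x, u), ⟨hx, hu⟩, rfl⟩

theorem Regular.norm_le_M (hreg : R.Regular l) {i : Fin N} {x : RState d} (hx : x ∈ R.X i)
    {v : RState d} (hv : v ∈ R.F i x) : ‖v‖ ≤ R.M i := by
  obtain ⟨u, hu, rfl⟩ := hv
  exact hreg.norm_f_le_M hx hu

theorem M_nonneg (R : RobotTeam N d) (i : Fin N) : 0 ≤ R.M i := by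
  refine Real.sSup_nonneg ?_
  rintro r ⟨x, -, u, -, rfl⟩
  exact norm_nonneg _

theorem Regular.F_nonempty (hreg : R.Regular l) (i : Fin N) (x : RState d) :
    (R.F i x).Nonempty := (hreg.U_nonempty i).image _

theorem Regular.F_compact (hreg : R.Regular l) {i : Fin N} {x : RState d} (hx : x ∈ R.X i) :
    IsCompact (R.F i x) := by
  refine (hreg.U_compact i).image_of_continuousOn ?_
  exact (hreg.f_continuous i).comp (f := fun u => (x, u)) (by fun_prop) fun u hu => ⟨hx, hu⟩

theorem le_sqrt_sum_sq {N : ℕ} (a : Fin N → ℝ) (i : Fin N) :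
    a i ≤ Real.sqrt (∑ j, a j ^ 2) :=
  Real.le_sqrt_of_sq_le
    (Finset.single_le_sum (f := fun j => a j ^ 2) (fun _ _ => sq_nonneg _) (Finset.mem_univ i))

theorem M_le_Mplus (R : RobotTeam N d) (i : Fin N) : R.M i ≤ R.Mplus := le_sqrt_sum_sq R.M i

theorem safe_subset_joint (R : RobotTeam N d) : R.safe ⊆ R.joint := fun _ hx i => (hx.1 i).1.1

end RobotTeam

/-! ### Arcs of the differential inclusion -/

theorem IsCompact.exists_tendsto_ultrafilter {ι α : Type*} [TopologicalSpace α] {K : Set α}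
    (hK : IsCompact K) (U : Ultrafilter ι) {f : ι → α} (hf : ∀ᶠ k in (U : Filter ι), f k ∈ K) :
    ∃ x ∈ K, Tendsto f U (𝓝 x) :=
  hK.ultrafilter_le_nhds' (U.map f) hf

namespace RobotTeam

variable {N d : ℕ} {R : RobotTeam N d} {l : Fin N → ℝ}

/-- The graph of F is closed: Lipschitz continuity puts v k within l ‖x k − x₀‖ of the compact set
F(x₀). -/
theorem Regular.mem_F_of_tendsto (hreg : R.Regular l) {i : Fin N} {ι : Type*} {L : Filter ι}
    [L.NeBot] {x : ι → RState d} {v : ι → RState d} {x₀ v₀ : RState d}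
    (hx : ∀ᶠ k in L, x k ∈ R.X i) (hx₀ : x₀ ∈ R.X i) (hv : ∀ᶠ k in L, v k ∈ R.F i (x k))
    (hxt : Tendsto x L (𝓝 x₀)) (hvt : Tendsto v L (𝓝 v₀)) : v₀ ∈ R.F i x₀ := by
  rw [← (hreg.F_compact hx₀).isClosed.closure_eq, Metric.mem_closure_iff_infDist_zero
    (hreg.F_nonempty i x₀)]
  have h1 : Tendsto (fun k => Metric.infDist (v k) (R.F i x₀)) L
      (𝓝 (Metric.infDist v₀ (R.F i x₀))) :=
    (Metric.continuous_infDist_pt _).continuousAt.tendsto.comp hvt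
  have h2 : Tendsto (fun k => l i * ‖x k - x₀‖) L (𝓝 0) := by
    have : Tendsto (fun k => ‖x k - x₀‖) L (𝓝 0) := tendsto_iff_norm_sub_tendsto_zero.1 hxt
    simpa using this.const_mul (l i)
  refine tendsto_nhds_unique h1 (squeeze_zero' (.of_forall fun _ => Metric.infDist_nonneg) ?_ h2)
  filter_upwards [hx, hv] with k hk hvk
  obtain ⟨w, hw, hle⟩ := hreg.F_lipschitz i _ hk _ hx₀ _ hvk
  exact (Metric.infDist_le_dist_of_mem hw).trans (by rwa [dist_eq_norm])

/-- `y` is, up to the error `a`, a trajectory of robot `i` which reaches the goal region at time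
`T` and rests from then on. The inclusion `y' ∈ F_i(y)` is expressed by increments, so that it is
stable under pointwise limits. -/
structure IsApproxArc (R : RobotTeam N d) (l : Fin N → ℝ) (i : Fin N) (a : ℝ) (y : ℝ → RState d)
    (T : ℝ) : Prop where
  nonneg : 0 ≤ T
  mem : ∀ s, 0 ≤ s → y s ∈ R.X i
  lip : ∀ s s', 0 ≤ s → s ≤ s' → ‖y s' - y s‖ ≤ R.M i * (s' - s) + a * (1 + (s' - s))
  step : ∀ s s', 0 ≤ s → s ≤ s' → s' ≤ T → ∃ v ∈ R.F i (y s),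
    ‖y s' - y s - (s' - s) • v‖ ≤
      l i * R.M i * (s' - s) ^ 2 + a * (1 + (s' - s) + (s' - s) ^ 2)
  rest : ∀ s, T ≤ s → y s = y T
  goal : ∃ g ∈ R.XG i, ‖y T - g‖ ≤ a

/-- A trajectory of robot `i` which reaches the goal region at time `T` and rests from then on. -/
abbrev IsArc (R : RobotTeam N d) (l : Fin N → ℝ) (i : Fin N) (y : ℝ → RState d) (T : ℝ) : Prop :=
  R.IsApproxArc l i 0 y T

theorem isArc_iff {i : Fin N} {y : ℝ → RState d} {T : ℝ} : R.IsArc l i y T ↔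
    0 ≤ T ∧ (∀ s, 0 ≤ s → y s ∈ R.X i) ∧
    (∀ s s', 0 ≤ s → s ≤ s' → ‖y s' - y s‖ ≤ R.M i * (s' - s)) ∧
    (∀ s s', 0 ≤ s → s ≤ s' → s' ≤ T → ∃ v ∈ R.F i (y s),
      ‖y s' - y s - (s' - s) • v‖ ≤ l i * R.M i * (s' - s) ^ 2) ∧
    (∀ s, T ≤ s → y s = y T) ∧ y T ∈ R.XG i := by
  constructor
  · rintro ⟨h1, h2, h3, h4, h5, g, hg, h6⟩
    have : y T = g := by simpa [sub_eq_zero] using h6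
    exact ⟨h1, h2, by simpa using h3, by simpa using h4, h5, this ▸ hg⟩
  · rintro ⟨h1, h2, h3, h4, h5, h6⟩
    exact ⟨h1, h2, by simpa using h3, by simpa using h4, h5, _, h6, by simp⟩

theorem IsApproxArc.eq_min {i : Fin N} {a : ℝ} {y : ℝ → RState d} {T : ℝ}
    (h : R.IsApproxArc l i a y T) (s : ℝ) : y s = y (min s T) := by
  rcases le_total s T with hs | hs
  · rw [min_eq_left hs]
  · rw [min_eq_right hs, h.rest s hs]

/-- Pointwise limits of approximate arcs along an ultrafilter exist and are arcs. -/
theorem Regular.exists_limit_arc (hreg : R.Regular l) {i : Fin N} (hG : IsClosed (R.XG i))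
    {ι : Type*} (U : Ultrafilter ι) {a : ι → ℝ} {y : ι → ℝ → RState d} {T : ι → ℝ} {T₀ : ℝ}
    (h : ∀ᶠ k in (U : Filter ι), R.IsApproxArc l i (a k) (y k) (T k))
    (ha : Tendsto a U (𝓝 0)) (hT : Tendsto T U (𝓝 T₀)) :
    ∃ Y : ℝ → RState d, (∀ s, 0 ≤ s → Tendsto (fun k => y k s) U (𝓝 (Y s))) ∧
      R.IsArc l i Y T₀ := by
  have hex : ∀ s, 0 ≤ s → ∃ z ∈ R.X i, Tendsto (fun k => y k s) U (𝓝 z) := fun s hs =>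
    (hreg.X_compact i).exists_tendsto_ultrafilter U (h.mono fun k hk => hk.mem s hs)
  choose! Y hYX hY using hex
  have hT₀ : 0 ≤ T₀ := ge_of_tendsto hT (h.mono fun k hk => hk.nonneg)
  have hlip0 : ∀ δ : ι → ℝ, ∀ δ₀ : ℝ, Tendsto δ U (𝓝 δ₀) →
      Tendsto (fun k => R.M i * δ k + a k * (1 + δ k)) U (𝓝 (R.M i * δ₀)) := fun δ δ₀ hδ => by
    simpa using (hδ.const_mul (R.M i)).add (ha.mul (hδ.const_add 1))
  -- The arrival times T k vary with k. Since y k is constant after T k, the points y k (T k) and y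
  -- k s merge for every s ≥ T₀; this gives both rest and arrival of the limit.
  have hend : ∀ s, T₀ ≤ s → Tendsto (fun k => y k (T k)) U (𝓝 (Y s)) := by
    intro s hs
    have hmin : Tendsto (fun k => T k - min s (T k)) U (𝓝 0) := by
      simpa [min_eq_right hs] using hT.sub (tendsto_const_nhds (x := s) |>.min hT)
    have h1 : Tendsto (fun k => y k (T k) - y k s) U (𝓝 0) := by
      refine squeeze_zero_norm' ?_ (by simpa using hlip0 _ _ hmin)
      filter_upwards [h] with k hk
      rw [hk.eq_min s]
      exact hk.lip _ _ (le_min (hT₀.trans hs) hk.nonneg) (min_le_right _ _)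
    simpa using h1.add (hY s (hT₀.trans hs))
  refine ⟨Y, hY, isArc_iff.2 ⟨hT₀, hYX, ?_, ?_, ?_, ?_⟩⟩
  · intro s s' hs hss
    refine le_of_tendsto_of_tendsto ((hY s' (hs.trans hss)).sub (hY s hs)).norm
      (hlip0 (fun _ => s' - s) _ tendsto_const_nhds) ?_
    filter_upwards [h] with k hk
    exact hk.lip _ _ hs hss
  · intro s s' hs hss hsT
    -- Although s' ≤ T₀, it may exceed T k, where the inclusion is not available. Both times are
    -- clamped at T k, which leaves the curve unchanged and disappears in the limit.
    have hstep : ∀ᶠ k in (U : Filter ι), ∃ v, v ∈ R.F i (y k s) ∧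
        ‖y k s' - y k s - (min s' (T k) - min s (T k)) • v‖ ≤
          l i * R.M i * (min s' (T k) - min s (T k)) ^ 2 + a k * (1 +
          (min s' (T k) - min s (T k)) + (min s' (T k) - min s (T k)) ^ 2) := by
      filter_upwards [h] with k hk
      obtain ⟨v, hv, hle⟩ := hk.step (min s (T k)) (min s' (T k)) (le_min hs hk.nonneg)
        (min_le_min_right _ hss) (min_le_right _ _)
      rw [← hk.eq_min, ← hk.eq_min] at hle
      rw [← hk.eq_min] at hv
      exact ⟨v, hv, hle⟩
    obtain ⟨v, hv⟩ := hstep.choice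
    obtain ⟨v₀, -, hvt⟩ := (isCompact_closedBall (0 : RState d) (R.M i)).exists_tendsto_ultrafilter
      U (f := v) (by
        filter_upwards [h, hv] with k hk hvk
        rw [mem_closedBall_zero_iff]
        exact hreg.norm_le_M (hk.mem s hs) hvk.1)
    refine ⟨v₀, hreg.mem_F_of_tendsto (h.mono fun k hk => hk.mem s hs) (hYX s hs)
      (hv.mono fun k hk => hk.1) (hY s hs) hvt, ?_⟩
    have hδ : Tendsto (fun k => min s' (T k) - min s (T k)) U (𝓝 (s' - s)) := by
      simpa [min_eq_left hsT, min_eq_left (hss.trans hsT)] using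
        ((tendsto_const_nhds (x := s')).min hT).sub ((tendsto_const_nhds (x := s)).min hT)
    refine le_of_tendsto_of_tendsto (((hY s' (hs.trans hss)).sub (hY s hs)).sub
      (hδ.smul hvt)).norm ?_ (hv.mono fun k hk => hk.2)
    simpa using ((hδ.pow 2).const_mul (l i * R.M i)).add
      (ha.mul ((hδ.const_add 1).add (hδ.pow 2)))
  · intro s hs
    exact tendsto_nhds_unique (hend s hs) (hend T₀ le_rfl)
  · have hg : ∀ᶠ k in (U : Filter ι), ∃ g, g ∈ R.XG i ∧ ‖y k (T k) - g‖ ≤ a k :=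
      h.mono fun k hk => hk.goal
    obtain ⟨g, hg⟩ := hg.choice
    have h1 : Tendsto (fun k => y k (T k) - g k) U (𝓝 0) :=
      squeeze_zero_norm' (hg.mono fun k hk => hk.2) ha
    have h2 : Tendsto g U (𝓝 (Y T₀)) := by simpa using (hend T₀ le_rfl).sub h1
    exact hG.mem_of_tendsto h2 (hg.mono fun k hk => hk.1)

/-- A joint trajectory from `x` in the safety region with arrival times at most `T`. -/
structure IsTeamArc (R : RobotTeam N d) (l : Fin N → ℝ) (x : JState N d) (y : ℝ → JState N d)
    (T : Fin N → ℝ) : Prop where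
  start : y 0 = x
  arc : ∀ i, R.IsArc l i (fun s => y s i) (T i)
  safe : ∀ s, 0 ≤ s → y s ∈ R.safe

/-- The vectors of times at which the team can have arrived. -/
def reachTimes (R : RobotTeam N d) (l : Fin N → ℝ) (x : JState N d) : Set (Fin N → ℝ) :=
  {T | ∃ y, R.IsTeamArc l x y T}

/-- The compactness principle behind both the closedness of `reachTimes` and the upper limit. Safety
is asked only for s > 0, because the starting grid point of a path need not be near the safety
region; at s = 0 it follows from continuity of the limit and closedness of that region. -/
theorem Regular.mem_reachTimes_of_tendsto (hreg : R.Regular l) (hR : R.WellPosed)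
    {ι : Type*} (U : Ultrafilter ι) {a : ι → ℝ} {y : ι → ℝ → JState N d} {T : ι → Fin N → ℝ}
    {T₀ : Fin N → ℝ} {x : JState N d}
    (h : ∀ᶠ k in (U : Filter ι), ∀ i, R.IsApproxArc l i (a k) (fun s => y k s i) (T k i))
    (ha : Tendsto a U (𝓝 0)) (hT : Tendsto T U (𝓝 T₀))
    (hx : Tendsto (fun k => y k 0) U (𝓝 x))
    (hsafe : ∀ s, 0 < s → ∀ᶠ k in (U : Filter ι), ∃ q ∈ R.safe, ‖y k s - q‖ ≤ a k) :
    T₀ ∈ R.reachTimes l x := by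
  have hlim := fun i => hreg.exists_limit_arc (hR.goal_closed i) U
    (h.mono fun k hk => hk i) ha (tendsto_pi_nhds.1 hT i)
  choose Y hY harc using hlim
  have htend : ∀ s, 0 ≤ s → Tendsto (fun k => y k s) U
      (𝓝 (WithLp.toLp 2 fun i => Y i s : JState N d)) := by
    intro s hs
    have h1 : Tendsto (fun k => fun i => y k s i) U (𝓝 fun i => Y i s) :=
      tendsto_pi_nhds.2 fun i => hY i s hs
    exact ((PiLp.continuous_toLp 2 (fun _ : Fin N => RState d)).tendsto _).comp h1
  have hpos : ∀ s, 0 < s → (WithLp.toLp 2 fun i => Y i s : JState N d) ∈ R.safe := by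
    intro s hs
    obtain ⟨q, hq⟩ := (hsafe s hs).choice
    have h1 : Tendsto (fun k => y k s - q k) U (𝓝 0) :=
      squeeze_zero_norm' (hq.mono fun k hk => hk.2) ha
    have h2 := (htend s hs.le).sub h1
    simp only [sub_sub_cancel, sub_zero] at h2
    exact hR.safe_closed.mem_of_tendsto h2 (hq.mono fun k hk => hk.1)
  refine ⟨fun s => WithLp.toLp 2 fun i => Y i s, tendsto_nhds_unique (htend 0 le_rfl) hx, harc,
    fun s hs => ?_⟩
  rcases hs.eq_or_lt with rfl | hs
  · have h1 : Tendsto (fun s => (WithLp.toLp 2 fun i => Y i s : JState N d)) (𝓝[>] 0)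
        (𝓝 (WithLp.toLp 2 fun i => Y i 0)) := by
      refine ((PiLp.continuous_toLp 2 (fun _ : Fin N => RState d)).tendsto _).comp
        (tendsto_pi_nhds.2 fun i => ?_)
      rw [tendsto_iff_norm_sub_tendsto_zero]
      have h2 : Tendsto (fun s : ℝ => R.M i * s) (𝓝[>] 0) (𝓝 0) := by
        have : Tendsto (fun s : ℝ => R.M i * s) (𝓝 0) (𝓝 (R.M i * 0)) :=
          (continuous_const_mul (R.M i)).tendsto 0
        rw [mul_zero] at this
        exact this.mono_left nhdsWithin_le_nhds
      refine squeeze_zero' (.of_forall fun _ => norm_nonneg _) ?_ h2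
      filter_upwards [self_mem_nhdsWithin] with s hs
      simpa using (isArc_iff.1 (harc i)).2.2.1 0 s le_rfl (le_of_lt hs)
    exact hR.safe_closed.mem_of_tendsto h1 (eventually_mem_nhdsWithin.mono fun s hs => hpos s hs)
  · exact hpos s hs

theorem Regular.isClosed_reachTimes (hreg : R.Regular l) (hR : R.WellPosed) (x : JState N d) :
    IsClosed (R.reachTimes l x) := by
  rw [isClosed_iff_ultrafilter]
  intro T₀ U hU hmem
  have h1 : ∀ T : Fin N → ℝ, ∃ y, T ∈ R.reachTimes l x → R.IsTeamArc l x y T := fun T => by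
    by_cases hT : T ∈ R.reachTimes l x
    · exact ⟨_, fun _ => hT.choose_spec⟩
    · exact ⟨fun _ => x, fun h => absurd h hT⟩
  choose y hy using h1
  have hev : ∀ᶠ T in (U : Filter (Fin N → ℝ)), T ∈ R.reachTimes l x := hmem
  -- The time vectors themselves index the family, and exact arcs have error 0.
  refine hreg.mem_reachTimes_of_tendsto hR U (a := fun _ => 0) (y := y) (T := id)
    (hev.mono fun T hT => (hy T hT).arc) tendsto_const_nhds hU ?_ ?_
  · refine tendsto_const_nhds.congr' (hev.mono fun T hT => ?_)
    exact (hy T hT).start.symm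
  · intro s hs
    filter_upwards [hev] with T hT
    exact ⟨_, (hy T hT).safe s hs.le, by simp⟩

/-- Below every vector of arrival times there is a minimal one. -/
theorem Regular.exists_minimal_reachTimes (hreg : R.Regular l) (hR : R.WellPosed)
    {x : JState N d} {T : Fin N → ℝ} (hT : T ∈ R.reachTimes l x) :
    ∃ T' ∈ R.reachTimes l x, T' ≤ T ∧ ∀ T'' ∈ R.reachTimes l x, T'' ≤ T' → T'' = T' := by
  have hnn : ∀ T ∈ R.reachTimes l x, (0 : Fin N → ℝ) ≤ T := by
    rintro T ⟨y, hy⟩ i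
    exact (hy.arc i).nonneg
  have hc : IsCompact (R.reachTimes l x ∩ Icc 0 T) :=
    isCompact_Icc.inter_left (hreg.isClosed_reachTimes hR x)
  -- A minimizer of the sum of the coordinates on the compact part below T is Pareto minimal.
  obtain ⟨T', ⟨hT', hT'T⟩, hmin⟩ := hc.exists_isMinOn ⟨T, hT, hnn T hT, le_rfl⟩
    (f := fun T => ∑ i, T i) (by fun_prop)
  refine ⟨T', hT', hT'T.2, fun T'' h h' => ?_⟩
  have hle : ∑ i, T' i ≤ ∑ i, T'' i := hmin ⟨h, hnn _ h, h'.trans hT'T.2⟩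
  funext i
  by_contra hne
  have : ∑ i, T'' i < ∑ i, T' i :=
    Finset.sum_lt_sum (fun j _ => h' j) ⟨i, Finset.mem_univ i, lt_of_le_of_ne (h' i) hne⟩
  linarith

end RobotTeam

namespace RobotTeam

variable {N d : ℕ} {R : RobotTeam N d} {l : Fin N → ℝ}

/-! ### Arcs and solutions of the differential inclusion -/

/-- Mean slopes are trapped twice: first in the ball of radius M, which gives the Lipschitz bound;
then, since the curve stays within M (s' − s) of y(s), in the convex closed thickening of F(y(s)) by
l M (s' − s). -/
theorem Regular.isArc_of_deriv (hreg : R.Regular l) {i : Fin N} {y : ℝ → RState d} {T : ℝ}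
    (hT : 0 ≤ T) (hmem : ∀ s, 0 ≤ s → y s ∈ R.X i)
    (hac : ∀ b : ℝ, 0 ≤ b → AbsolutelyContinuousOnInterval y 0 b)
    (hd : ∀ᵐ s : ℝ, 0 < s → s < T → ∃ v ∈ R.F i (y s), HasDerivAt y v s)
    (hrest : ∀ s, T ≤ s → y s = y T) (hgoal : y T ∈ R.XG i) : R.IsArc l i y T := by
  have hac' : ∀ s s', 0 ≤ s → s ≤ s' → AbsolutelyContinuousOnInterval y s s' := by
    intro s s' hs hss
    refine (hac s' (hs.trans hss)).mono ?_
    rw [uIcc_of_le hss, uIcc_of_le (hs.trans hss)]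
    exact Icc_subset_Icc_left hs
  have hlip : ∀ s s', 0 ≤ s → s ≤ s' → s' ≤ T → ‖y s' - y s‖ ≤ R.M i * (s' - s) := by
    intro s s' hs hss hsT
    rcases hss.eq_or_lt with rfl | hlt
    · simp
    have hpos : 0 < s' - s := sub_pos.2 hlt
    have h1 := (hac' s s' hs hss).slope_mem_of_ae_deriv_mem hlt
      (convex_closedBall (0 : RState d) (R.M i)) Metric.isClosed_closedBall (by
        filter_upwards [hd] with r hr hmr
        obtain ⟨v, hv, hdv⟩ := hr (hs.trans_lt hmr.1) (hmr.2.trans_le hsT)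
        exact ⟨v, mem_closedBall_zero_iff.2
          (hreg.norm_le_M (hmem r (hs.trans hmr.1.le)) hv), hdv⟩)
    rw [mem_closedBall_zero_iff, norm_smul, norm_inv, Real.norm_of_nonneg hpos.le,
      inv_mul_le_iff₀ hpos] at h1
    linarith
  refine isArc_iff.2 ⟨hT, hmem, ?_, ?_, hrest, hgoal⟩
  · intro s s' hs hss
    have hmin : ∀ s, y s = y (min s T) := fun s => by
      rcases le_total s T with h | h
      · rw [min_eq_left h]
      · rw [min_eq_right h, hrest s h]
    rw [hmin s, hmin s']
    refine (hlip _ _ (le_min hs hT) (min_le_min_right _ hss) (min_le_right _ _)).trans ?_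
    have : min s' T - min s T ≤ s' - s := by
      rcases le_total s T with h | h <;> rcases le_total s' T with h' | h' <;>
        simp [h, h'] <;> linarith
    exact mul_le_mul_of_nonneg_left this (R.M_nonneg i)
  · intro s s' hs hss hsT
    rcases hss.eq_or_lt with rfl | hlt
    · obtain ⟨v, hv⟩ := hreg.F_nonempty i (y s)
      exact ⟨v, hv, by simp⟩
    have hpos : 0 < s' - s := sub_pos.2 hlt
    have hK : 0 ≤ l i * R.M i * (s' - s) :=
      mul_nonneg (mul_nonneg (hreg.l_nonneg i) (R.M_nonneg i)) hpos.le
    have h1 := (hac' s s' hs hss).slope_mem_of_ae_deriv_mem hlt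
      (C := Metric.cthickening (l i * R.M i * (s' - s)) (R.F i (y s)))
      ((hreg.F_convex i _ (hmem s hs)).cthickening _) Metric.isClosed_cthickening (by
        filter_upwards [hd] with r hr hmr
        obtain ⟨v, hv, hdv⟩ := hr (hs.trans_lt hmr.1) (hmr.2.trans_le hsT)
        obtain ⟨w, hw, hle⟩ := hreg.F_lipschitz i _ (hmem r (hs.trans hmr.1.le)) _ (hmem s hs) _ hv
        refine ⟨v, Metric.mem_cthickening_of_dist_le _ w _ _ hw ?_, hdv⟩
        rw [dist_eq_norm]
        refine hle.trans ?_
        rw [mul_assoc]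
        refine mul_le_mul_of_nonneg_left ?_ (hreg.l_nonneg i)
        refine (hlip s r hs hmr.1.le (hmr.2.le.trans hsT)).trans ?_
        exact mul_le_mul_of_nonneg_left (by linarith [hmr.2]) (R.M_nonneg i))
    rw [(hreg.F_compact (hmem s hs)).cthickening_eq_biUnion_closedBall hK] at h1
    simp only [mem_iUnion, Metric.mem_closedBall] at h1
    obtain ⟨v, hv, hle⟩ := h1
    refine ⟨v, hv, ?_⟩
    have h2 : y s' - y s - (s' - s) • v = (s' - s) • ((s' - s)⁻¹ • (y s' - y s) - v) := by
      rw [smul_sub, smul_inv_smul₀ hpos.ne']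
    rw [h2, norm_smul, Real.norm_of_nonneg hpos.le, ← dist_eq_norm]
    nlinarith [mul_le_mul_of_nonneg_left hle hpos.le]

theorem IsApproxArc.deriv_mem (hreg : R.Regular l) {i : Fin N} {y : ℝ → RState d} {T : ℝ}
    (h : R.IsArc l i y T) {s : ℝ} (hs : 0 ≤ s) (hsT : s < T) {v : RState d}
    (hd : HasDerivAt y v s) : v ∈ R.F i (y s) := by
  have hmem := h.mem s hs
  rw [← (hreg.F_compact hmem).isClosed.closure_eq, Metric.mem_closure_iff_infDist_zero
    (hreg.F_nonempty i _)]
  have h1 : Tendsto (fun t : ℝ => Metric.infDist (t⁻¹ • (y (s + t) - y s)) (R.F i (y s)))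
      (𝓝[>] 0) (𝓝 (Metric.infDist v (R.F i (y s)))) :=
    (Metric.continuous_infDist_pt _).continuousAt.tendsto.comp hd.tendsto_slope_zero_right
  have h2 : Tendsto (fun t : ℝ => l i * R.M i * t) (𝓝[>] 0) (𝓝 0) := by
    have : Tendsto (fun t : ℝ => l i * R.M i * t) (𝓝 0) (𝓝 (l i * R.M i * 0)) :=
      (continuous_const_mul _).tendsto 0
    rw [mul_zero] at this
    exact this.mono_left nhdsWithin_le_nhds
  refine tendsto_nhds_unique h1 (squeeze_zero' (.of_forall fun _ => Metric.infDist_nonneg) ?_ h2)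
  filter_upwards [Ioo_mem_nhdsGT (sub_pos.2 hsT)] with t ht
  obtain ⟨w, hw, hle⟩ := (isArc_iff.1 h).2.2.2.1 s (s + t) hs (by linarith [ht.1])
    (by linarith [ht.2])
  refine (Metric.infDist_le_dist_of_mem hw).trans ?_
  rw [dist_eq_norm]
  have hpos : 0 < t := ht.1
  rw [add_sub_cancel_left] at hle
  have h3 : t⁻¹ • (y (s + t) - y s) - w = t⁻¹ • (y (s + t) - y s - t • w) := by
    rw [smul_sub t⁻¹ (_ - _) (t • w), inv_smul_smul₀ hpos.ne']
  rw [h3, norm_smul, norm_inv, Real.norm_of_nonneg hpos.le, inv_mul_le_iff₀ hpos]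
  linarith

theorem IsApproxArc.lipschitzOnWith {i : Fin N} {y : ℝ → RState d} {T : ℝ}
    (h : R.IsArc l i y T) : LipschitzOnWith (R.M i).toNNReal y (Ici 0) := by
  have key : ∀ s s', 0 ≤ s → s ≤ s' → dist (y s) (y s') ≤ R.M i * dist s s' := by
    intro s s' hs hss
    rw [dist_comm, dist_eq_norm, dist_comm s, Real.dist_eq, abs_of_nonneg (sub_nonneg.2 hss)]
    exact (isArc_iff.1 h).2.2.1 s s' hs hss
  refine LipschitzOnWith.of_dist_le_mul fun s hs s' hs' => ?_
  rw [Real.coe_toNNReal _ (R.M_nonneg i)]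
  rcases le_total s s' with hss | hss
  · exact key s s' hs hss
  · rw [dist_comm, dist_comm s]
    exact key s' s hs' hss

/-- Arcs are Lipschitz, hence differentiable almost everywhere, and the increment condition divided
by a vanishing time step puts the derivative into F. -/
theorem IsApproxArc.ae_hasDerivAt (hreg : R.Regular l) {i : Fin N} {y : ℝ → RState d} {T : ℝ}
    (h : R.IsArc l i y T) : ∀ᵐ s : ℝ, 0 < s → s < T → ∃ u ∈ R.U i,
      HasDerivAt y (R.f i (y s) u) s := by
  filter_upwards [h.lipschitzOnWith.ae_differentiableWithinAt_of_mem_real] with s hs h0 hsT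
  have hd := ((hs h0.le).differentiableAt (Ici_mem_nhds h0)).hasDerivAt
  obtain ⟨u, hu, hu'⟩ := h.deriv_mem hreg h0.le hsT hd
  exact ⟨u, hu, by rw [hu']; exact hd⟩

/-! ### Stopping early and cutting loops -/

theorem IsApproxArc.restAt {i : Fin N} {y : ℝ → RState d} {T : ℝ} (h : R.IsArc l i y T) {s₀ : ℝ}
    (h0 : 0 ≤ s₀) (hs₀ : s₀ ≤ T) (hg : y s₀ ∈ R.XG i) :
    R.IsArc l i (fun s => y (min s s₀)) s₀ := by
  obtain ⟨-, h2, h3, h4, -, -⟩ := isArc_iff.1 h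
  refine isArc_iff.2 ⟨h0, fun s hs => h2 _ (le_min hs h0), fun s s' hs hss => ?_,
    fun s s' hs hss hs' => ?_, fun s hs => ?_, by simpa using hg⟩
  · refine (h3 _ _ (le_min hs h0) (min_le_min_right _ hss)).trans ?_
    have : min s' s₀ - min s s₀ ≤ s' - s := by
      rcases le_total s s₀ with h | h <;> rcases le_total s' s₀ with h' | h' <;>
        simp [h, h'] <;> linarith
    exact mul_le_mul_of_nonneg_left this (R.M_nonneg i)
  · simp only [min_eq_left hs', min_eq_left (hss.trans hs')]
    exact h4 s s' hs hss (hs'.trans hs₀)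
  · simp [min_eq_right hs]

/-- Only increments across the cut need an argument. With a = s₁ − s and b = s' − s₁, the velocity
after the cut is moved to F(y(s)) at cost l M a, and convexity supplies the weighted mean of both
velocities. The errors add up to l M (a² + b² + ab) ≤ l M (a + b)². -/
theorem IsApproxArc.cut (hreg : R.Regular l) {i : Fin N} {y : ℝ → RState d} {T : ℝ}
    (h : R.IsArc l i y T) {s₁ s₂ : ℝ} (h1 : 0 ≤ s₁) (h12 : s₁ ≤ s₂) (heq : y s₁ = y s₂)
    (hT : s₂ ≤ T) :
    R.IsArc l i (fun s => if s ≤ s₁ then y s else y (s + (s₂ - s₁))) (T - (s₂ - s₁)) := by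
  obtain ⟨-, hmem, hlip, hstep, hrest, hgoal⟩ := isArc_iff.1 h
  have hval : ∀ s, s₁ ≤ s → (if s ≤ s₁ then y s else y (s + (s₂ - s₁))) = y (s + (s₂ - s₁)) := by
    intro s hs
    rcases hs.eq_or_lt with rfl | hs
    · simp [heq]
    · rw [if_neg hs.not_ge]
  have hX := hmem
  refine isArc_iff.2 ⟨by linarith, fun s hs => ?_, fun s s' hs hss => ?_,
    fun s s' hs hss hs' => ?_, fun s hs => ?_, ?_⟩
  · split_ifs
    · exact hmem s hs
    · exact hmem _ (by linarith)
  · rcases le_total s' s₁ with h' | h'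
    · rw [if_pos h', if_pos (hss.trans h')]
      exact hlip s s' hs hss
    rw [hval s' h']
    rcases le_total s s₁ with h'' | h''
    · rw [if_pos h'']
      have e1 := hlip s s₁ hs h''
      have e2 := hlip s₂ (s' + (s₂ - s₁)) (by linarith) (by linarith)
      have e3 : y (s' + (s₂ - s₁)) - y s = (y (s' + (s₂ - s₁)) - y s₂) + (y s₁ - y s) := by
        rw [heq]; abel
      rw [e3]
      refine (norm_add_le _ _).trans ?_
      linarith
    · rw [hval s h'']
      have := hlip (s + (s₂ - s₁)) (s' + (s₂ - s₁)) (by linarith) (by linarith)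
      linarith
  · rcases le_total s' s₁ with h' | h'
    · rw [if_pos h', if_pos (hss.trans h')]
      exact hstep s s' hs hss (by linarith)
    rw [hval s' h']
    rcases le_total s s₁ with h'' | h''
    · rw [if_pos h'']
      rcases hss.eq_or_lt with rfl | hlt
      · obtain ⟨v, hv⟩ := hreg.F_nonempty i (y s)
        have : s = s₁ := le_antisymm h'' h'
        subst this
        exact ⟨v, hv, by simp [heq]⟩
      obtain ⟨v₁, hv₁, e1⟩ := hstep s s₁ hs h'' (by linarith)
      obtain ⟨v₂, hv₂, e2⟩ := hstep s₂ (s' + (s₂ - s₁)) (by linarith) (by linarith) (by linarith)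
      rw [← heq] at hv₂
      obtain ⟨w, hw, e3⟩ := hreg.F_lipschitz i _ (hX s₁ h1) _ (hX s hs) _ hv₂
      have e4 := hlip s s₁ hs h''
      have hpos : 0 < s' - s := by linarith
      refine ⟨((s₁ - s) / (s' - s)) • v₁ + ((s' - s₁) / (s' - s)) • w,
        hreg.F_convex i _ (hX s hs) hv₁ hw (div_nonneg (by linarith) hpos.le)
          (div_nonneg (by linarith) hpos.le) (by field_simp; ring), ?_⟩
      have e5 : (s' - s) • (((s₁ - s) / (s' - s)) • v₁ + ((s' - s₁) / (s' - s)) • w) =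
          (s₁ - s) • v₁ + (s' - s₁) • w := by
        rw [smul_add, smul_smul, smul_smul, mul_div_cancel₀ _ hpos.ne', mul_div_cancel₀ _ hpos.ne']
      have e6 : s' + (s₂ - s₁) - s₂ = s' - s₁ := by ring
      rw [e6] at e2
      have e7 : y (s' + (s₂ - s₁)) - y s - ((s₁ - s) • v₁ + (s' - s₁) • w) =
          (y (s' + (s₂ - s₁)) - y s₂ - (s' - s₁) • v₂) + (y s₁ - y s - (s₁ - s) • v₁) +
            (s' - s₁) • (v₂ - w) := by
        rw [heq, smul_sub]; abel
      rw [e5, e7]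
      refine (norm_add₃_le).trans ?_
      rw [norm_smul, Real.norm_of_nonneg (by linarith : 0 ≤ s' - s₁)]
      have hl := hreg.l_nonneg i
      have hM := R.M_nonneg i
      have e8 : (s' - s₁) * ‖v₂ - w‖ ≤ (s' - s₁) * (l i * (R.M i * (s₁ - s))) :=
        mul_le_mul_of_nonneg_left (e3.trans (mul_le_mul_of_nonneg_left e4 hl)) (by linarith)
      have e9 : 0 ≤ l i * R.M i * ((s' - s₁) * (s₁ - s)) :=
        mul_nonneg (mul_nonneg hl hM) (mul_nonneg (by linarith) (by linarith))
      nlinarith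
    · rw [hval s h'']
      have := hstep (s + (s₂ - s₁)) (s' + (s₂ - s₁)) (by linarith) (by linarith) (by linarith)
      rwa [add_sub_add_right_eq_sub] at this
  · rw [hval s (by linarith), hval _ (by linarith), sub_add_cancel]
    exact hrest _ (by linarith)
  · rw [hval _ (by linarith), sub_add_cancel]
    exact hgoal

theorem IsApproxArc.cut_of_le {i : Fin N} {y : ℝ → RState d} {T : ℝ}
    (h : R.IsArc l i y T) {s₁ s₂ : ℝ} (h12 : s₁ ≤ s₂) (hT : T ≤ s₁) :
    R.IsArc l i (fun s => if s ≤ s₁ then y s else y (s + (s₂ - s₁))) T := by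
  have : (fun s => if s ≤ s₁ then y s else y (s + (s₂ - s₁))) = y := by
    funext s
    split_ifs with hs
    · rfl
    · rw [h.rest s (by linarith), h.rest _ (by linarith)]
  rwa [this]

/-! ### Minimal arrival times are arrival times of policies -/

/-- A robot at rest in its goal region does not interfere with the others. -/
theorem safe_of_goal (R : RobotTeam N d) {q x : JState N d} (hx : x ∈ R.safe)
    (hF : ∀ i, q i ∈ R.XF i) (hq : ∀ i, q i = x i ∨ q i ∈ R.XG i) : q ∈ R.safe := by
  refine ⟨hF, fun i j hij => ?_⟩
  rcases hq i with hi | hi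
  · rcases hq j with hj | hj
    · rw [hi, hj]; exact hx.2 i j hij
    · exact (hF i).2 j hij.symm _ hj
  · rw [norm_sub_rev]; exact (hF j).2 i hij _ hi

variable {x : JState N d} {y : ℝ → JState N d} {T : Fin N → ℝ}

/-- Otherwise robot i could be frozen at time s, which improves its time alone. The joint arc stays
safe because free regions keep distance σ from the goals of other robots. -/
theorem IsTeamArc.notMem_goal_of_minimal (h : R.IsTeamArc l x y T)
    (hmin : ∀ T' ∈ R.reachTimes l x, T' ≤ T → T' = T) {i : Fin N} {s : ℝ} (hs : 0 ≤ s)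
    (hsT : s < T i) : y s i ∉ R.XG i := by
  intro hg
  classical
  let y' : ℝ → JState N d := fun r => WithLp.toLp 2 fun j => if j = i then y (min r s) j else y r j
  have hy' : ∀ r j, y' r j = if j = i then y (min r s) j else y r j := fun r j => rfl
  have hmem : Function.update T i s ∈ R.reachTimes l x := by
    refine ⟨y', ?_, fun j => ?_, fun r hr => ?_⟩
    · ext1 j
      rw [hy', min_eq_left hs, ite_self, h.start]
    · by_cases hj : j = i
      · subst hj
        simp only [hy', if_true, Function.update_self]
        exact (h.arc j).restAt hs hsT.le hg
      · simp only [hy', if_neg hj, Function.update_of_ne hj]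
        exact h.arc j
    · refine R.safe_of_goal (h.safe r hr) (fun j => ?_) fun j => ?_
      · rw [hy']
        split_ifs
        · exact (h.safe _ (le_min hr hs)).1 j
        · exact (h.safe _ hr).1 j
      · rw [hy']
        split_ifs with hj
        · subst hj
          rcases le_total r s with hrs | hrs
          · left; rw [min_eq_left hrs]
          · right; rw [min_eq_right hrs]; exact hg
        · left; rfl
  have heq := hmin _ hmem (update_le_iff.2 ⟨hsT.le, fun _ _ => le_rfl⟩)
  have := congrFun heq i
  rw [Function.update_self] at this
  exact hsT.ne this

theorem IsTeamArc.le_of_loop (hreg : R.Regular l) (h : R.IsTeamArc l x y T)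
    (hmin : ∀ T' ∈ R.reachTimes l x, T' ≤ T → T' = T) {s₁ s₂ : ℝ} (hs : 0 ≤ s₁) (h12 : s₁ < s₂)
    (heq : y s₁ = y s₂) (i : Fin N) : T i ≤ s₁ := by
  -- No robot arrives strictly inside the loop: it would be in its goal at s₂, hence already at s₁,
  -- before its minimal arrival time.
  have hdich : ∀ j, T j ≤ s₁ ∨ s₂ ≤ T j := by
    intro j
    by_contra! hn
    refine h.notMem_goal_of_minimal hmin hs hn.1 ?_
    rw [heq, (h.arc j).rest s₂ hn.2.le]
    exact (isArc_iff.1 (h.arc j)).2.2.2.2.2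
  by_contra! hi
  let y' : ℝ → JState N d := fun r => if r ≤ s₁ then y r else y (r + (s₂ - s₁))
  have hy' : ∀ j, (fun r => y' r j) =
      fun r => if r ≤ s₁ then y r j else y (r + (s₂ - s₁)) j := by
    intro j
    funext r
    simp only [y']
    split_ifs <;> rfl
  have hmem : (fun j => if T j ≤ s₁ then T j else T j - (s₂ - s₁)) ∈ R.reachTimes l x := by
    refine ⟨y', ?_, fun j => ?_, fun r hr => ?_⟩
    · simp only [y', if_pos hs, h.start]
    · rw [hy']
      split_ifs with hj
      · exact (h.arc j).cut_of_le h12.le hj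
      · exact (h.arc j).cut hreg hs h12.le (by rw [heq]) ((hdich j).resolve_left hj)
    · simp only [y']
      split_ifs
      · exact h.safe r hr
      · exact h.safe _ (by linarith)
  have hle := hmin _ hmem (fun j => by
    dsimp only
    split_ifs
    · exact le_rfl
    · linarith)
  have := congrFun hle i
  simp only [if_neg hi.not_ge] at this
  linarith

theorem IsTeamArc.exists_policy (hreg : R.Regular l) (h : R.IsTeamArc l x y T)
    (hmin : ∀ T' ∈ R.reachTimes l x, T' ≤ T → T' = T) :
    ∃ π, R.IsPolicy π ∧ R.IsExecution π x y fun i => ENNReal.ofReal (T i) := by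
  classical
  have hT := fun i => (h.arc i).nonneg
  -- While robot i is under way, the joint state determines the time. This makes the feedback below
  -- unambiguous.
  have hinj : ∀ i s s', 0 ≤ s → 0 ≤ s' → s < T i → s' < T i → y s = y s' → s = s' := by
    intro i s s' hs hs' hsT hsT' heq
    rcases lt_trichotomy s s' with hlt | heq' | hlt
    · exact absurd (h.le_of_loop hreg hmin hs hlt heq i) hsT.not_ge
    · exact heq'
    · exact absurd (h.le_of_loop hreg hmin hs' hlt heq.symm i) hsT'.not_ge
  let P : (i : Fin N) → JState N d → EuclideanSpace ℝ (Fin (R.m i)) → Prop := fun i z u =>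
    ∃ s, 0 ≤ s ∧ s < T i ∧ y s = z ∧ u ∈ R.U i ∧
      HasDerivAt (fun r => y r i) (R.f i (y s i) u) s
  let π : (i : Fin N) → JState N d → EuclideanSpace ℝ (Fin (R.m i)) := fun i z =>
    if hz : ∃ u, P i z u then hz.choose else (hreg.U_nonempty i).some
  have hπ : ∀ i z, (∃ u, P i z u) → P i z (π i z) := fun i z hz => by
    simp only [π, dif_pos hz]
    exact hz.choose_spec
  refine ⟨π, fun i z _ => ?_, h.start, fun i b hb => ?_, fun i => ?_, fun i s hs hsT => ?_,
    fun i _ => ?_, fun i s hs hsT => ?_, fun i s hs _ => h.safe s hs⟩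
  · by_cases hz : ∃ u, P i z u
    · obtain ⟨s, -, -, -, hu, -⟩ := hπ i z hz
      exact hu
    · simp only [π, dif_neg hz]
      exact (hreg.U_nonempty i).some_mem
  · refine LipschitzOnWith.absolutelyContinuousOnInterval ((h.arc i).lipschitzOnWith.mono ?_)
    rw [uIcc_of_le hb]
    exact Icc_subset_Ici_self
  · filter_upwards [(h.arc i).ae_hasDerivAt hreg] with s hs h0 hsT
    rw [ENNReal.ofReal_lt_ofReal_iff_of_nonneg h0.le] at hsT
    obtain ⟨u, hu, hd⟩ := hs h0 hsT
    obtain ⟨s', h0', hsT', heq, -, hd'⟩ := hπ i (y s) ⟨u, s, h0.le, hsT, rfl, hu, hd⟩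
    obtain rfl := hinj i s' s h0' h0.le hsT' hsT heq
    exact hd'
  · rw [ENNReal.ofReal_lt_ofReal_iff_of_nonneg hs] at hsT
    exact h.notMem_goal_of_minimal hmin hs hsT
  · rw [ENNReal.toReal_ofReal (hT i)]
    exact (isArc_iff.1 (h.arc i)).2.2.2.2.2
  · rw [ENNReal.ofReal_le_ofReal_iff hs] at hsT
    rw [ENNReal.toReal_ofReal (hT i)]
    exact (h.arc i).rest s hsT

/-- Executions are required to be safe only until the last arrival; afterwards the whole team rests
at a safe state. A last robot exists because N > 0. -/
theorem IsExecution.safe_of_nonneg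
    {π : (i : Fin N) → JState N d → EuclideanSpace ℝ (Fin (R.m i))} {t : TimeVec N}
    (h : R.IsExecution π x y t) (hN : 0 < N) (s : ℝ) (hs : 0 ≤ s) : y s ∈ R.safe := by
  have : Nonempty (Fin N) := ⟨⟨0, hN⟩⟩
  obtain ⟨i, hi⟩ := Finite.exists_max t
  rcases le_total (ENNReal.ofReal s) (t i) with hsi | hsi
  · exact h.safety i s hs hsi
  · have hfin : t i ≠ ∞ := ne_top_of_le_ne_top ENNReal.ofReal_ne_top hsi
    have heq : y s = y (t i).toReal := by
      ext1 j
      rw [h.rest j s hs ((hi j).trans hsi), h.rest j (t i).toReal ENNReal.toReal_nonneg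
        (by rw [ENNReal.ofReal_toReal hfin]; exact hi j)]
    rw [heq]
    exact h.safety i _ ENNReal.toReal_nonneg (by rw [ENNReal.ofReal_toReal hfin])

theorem IsExecution.isTeamArc (hreg : R.Regular l)
    {π : (i : Fin N) → JState N d → EuclideanSpace ℝ (Fin (R.m i))} {t : TimeVec N}
    (h : R.IsExecution π x y t) (hπ : R.IsPolicy π) (hN : 0 < N) (ht : ∀ i, t i ≠ ∞) :
    R.IsTeamArc l x y fun i => (t i).toReal := by
  have hsafe := h.safe_of_nonneg hN
  have hlt : ∀ i s, 0 ≤ s → s < (t i).toReal → ENNReal.ofReal s < t i := fun i s hs hst =>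
    (ENNReal.ofReal_lt_iff_lt_toReal hs (ht i)).2 hst
  refine ⟨h.start, fun i => hreg.isArc_of_deriv ENNReal.toReal_nonneg
    (fun s hs => R.safe_subset_joint (hsafe s hs) i) (h.abs_cont i) ?_ (fun s hs => ?_)
    (h.arrival i (ht i)), hsafe⟩
  · filter_upwards [h.dynamics i] with s hs h0 hsT
    exact ⟨_, ⟨_, hπ i _ (R.safe_subset_joint (hsafe s h0.le)), rfl⟩, hs h0 (hlt i s h0.le hsT)⟩
  · exact h.rest i s (ENNReal.toReal_nonneg.trans hs)
      ((ENNReal.le_ofReal_iff_toReal_le (ht i) (ENNReal.toReal_nonneg.trans hs)).2 hs)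

/-- The epigraph of the minimal arrival times in terms of arcs. -/
theorem Regular.mem_epiProfile_minArrival (hreg : R.Regular l) (hR : R.WellPosed) (hN : 0 < N)
    (x : JState N d) (t : EuclideanSpace ℝ (Fin N)) :
    t ∈ epiProfile R.minArrival x ↔ ∃ T ∈ R.reachTimes l x, ∀ i, T i ≤ t i := by
  have hfin : ∀ t' : TimeVec N, (∃ π, R.IsPolicy π ∧ t' ∈ R.arrivalTimes π x) →
      (∀ i, t' i ≠ ∞) → (fun i => (t' i).toReal) ∈ R.reachTimes l x := by
    rintro t' ⟨π, hπ, ⟨y, hy⟩ | ⟨-, rfl⟩⟩ ht'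
    · exact ⟨y, hy.isTeamArc hreg hπ hN ht'⟩
    · exact absurd rfl (ht' ⟨0, hN⟩)
  constructor
  · rintro ⟨t', ⟨ht', -⟩, hle⟩
    exact ⟨_, hfin t' ht' fun i => (hle i).1, fun i => (hle i).2⟩
  · rintro ⟨T, hT, hle⟩
    obtain ⟨T', hT', hT'T, hmin⟩ := hreg.exists_minimal_reachTimes hR hT
    obtain ⟨y, hy⟩ := hT'
    obtain ⟨π, hπ, hex⟩ := hy.exists_policy hreg hmin
    have hT0 : ∀ i, 0 ≤ T' i := fun i => (hy.arc i).nonneg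
    refine ⟨fun i => ENNReal.ofReal (T' i), ⟨⟨π, hπ, .inl ⟨y, hex⟩⟩, ?_⟩, fun i =>
      ⟨ENNReal.ofReal_ne_top, by
        rw [ENNReal.toReal_ofReal (hT0 i)]; exact (hT'T i).trans (hle i)⟩⟩
    rintro ⟨t'', ht'', hne, hle''⟩
    have hf : ∀ i, t'' i ≠ ∞ := fun i => ne_top_of_le_ne_top ENNReal.ofReal_ne_top (hle'' i)
    have := hmin _ (hfin t'' ht'' hf) fun i => ENNReal.toReal_le_of_le_ofReal (hT0 i) (hle'' i)
    refine hne (funext fun i => ?_)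
    rw [← ENNReal.ofReal_toReal (hf i), ← congrFun this i]

end RobotTeam

/-! ### Kuratowski limits -/

theorem kuratowskiLiminf_subset_limsup {α : Type*} [PseudoEMetricSpace α] (A : ℕ → Set α) :
    kuratowskiLiminf A ⊆ kuratowskiLimsup A := fun _ hx => Tendsto.liminf_eq hx

theorem IsKuratowskiLimit.of_subset {α : Type*} [PseudoEMetricSpace α] {A : ℕ → Set α}
    {L : Set α} (h1 : L ⊆ kuratowskiLiminf A) (h2 : kuratowskiLimsup A ⊆ L) :
    IsKuratowskiLimit A L :=
  ⟨((kuratowskiLiminf_subset_limsup A).trans h2).antisymm h1,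
    h2.antisymm (h1.trans (kuratowskiLiminf_subset_limsup A))⟩

theorem frequently_inter_nonempty_of_mem_kuratowskiLimsup {α : Type*} [PseudoEMetricSpace α]
    {A : ℕ → Set α} {x : α} (hx : x ∈ kuratowskiLimsup A) {V : Set α} (hV : V ∈ 𝓝 x) :
    ∃ᶠ n in atTop, (A n ∩ V).Nonempty := by
  obtain ⟨δ, hδ, hsub⟩ := EMetric.mem_nhds_iff.1 hV
  have hlt : liminf (fun n => Metric.infEDist x (A n)) atTop < δ := by
    rw [show liminf (fun n => Metric.infEDist x (A n)) atTop = 0 from hx]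
    exact hδ
  refine (frequently_lt_of_liminf_lt (by isBoundedDefault) hlt).mono fun n hn => ?_
  obtain ⟨a, ha, hd⟩ := Metric.infEDist_lt_iff.1 hn
  exact ⟨a, ha, hsub (by rwa [Metric.mem_eball, edist_comm])⟩

theorem mem_kuratowskiLiminf_of_eventually_mem {α : Type*} [PseudoEMetricSpace α]
    {A : ℕ → Set α} {x : α} (hx : ∀ᶠ n in atTop, x ∈ A n) : x ∈ kuratowskiLiminf A :=
  tendsto_const_nhds.congr' (hx.mono fun _ hn => (Metric.infEDist_zero_of_mem hn).symm)

/-! ### Pareto frontiers of lattice points -/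

/-- Frontiers depend only on upward closures. This permits replacing Bellman candidates by lattice
vectors. -/
theorem paretoFrontier_eq_of_dominated {N : ℕ} {A B : Set (TimeVec N)}
    (hAB : ∀ a ∈ A, ∃ b ∈ B, b ≤ a) (hBA : ∀ b ∈ B, ∃ a ∈ A, a ≤ b) :
    paretoFrontier A = paretoFrontier B := by
  have key : ∀ {A B : Set (TimeVec N)}, (∀ a ∈ A, ∃ b ∈ B, b ≤ a) → (∀ b ∈ B, ∃ a ∈ A, a ≤ b) →
      paretoFrontier A ⊆ paretoFrontier B := by
    rintro A B hAB hBA t ⟨ht, hmin⟩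
    have hA : ∀ a ∈ A, a ≤ t → a = t := fun a ha hat => by
      by_contra hne
      exact hmin ⟨a, ha, hne, hat⟩
    have hB : ∀ b ∈ B, b ≤ t → b = t := fun b hb hbt => by
      obtain ⟨a, ha, hab⟩ := hBA b hb
      have := hA a ha (hab.trans hbt)
      exact hbt.antisymm (this ▸ hab)
    obtain ⟨b, hb, hbt⟩ := hAB t ht
    refine ⟨hB b hb hbt ▸ hb, ?_⟩
    rintro ⟨b', hb', hne, hle⟩
    exact hne (hB b' hb' hle)
  exact (key hAB hBA).antisymm (key hBA hAB)

theorem paretoFrontier_singleton {N : ℕ} (t : TimeVec N) : paretoFrontier {t} = {t} := by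
  ext a
  constructor
  · exact fun h => h.1
  · rintro rfl
    exact ⟨rfl, by rintro ⟨t', rfl, hne, -⟩; exact hne rfl⟩

/-- The time vectors `τ c` for `c ∈ C`. -/
def latticeTimes {N : ℕ} (τ : ℝ) (C : Set (Fin N → ℕ)) : Set (TimeVec N) :=
  (fun c i => ENNReal.ofReal (τ * c i)) '' C

open Classical in
/-- The Pareto frontier of the time vectors `τ c` for `c ∈ C`, infinite if `C` is empty. -/
noncomputable def latticeFrontier {N : ℕ} (τ : ℝ) (C : Set (Fin N → ℕ)) : Set (TimeVec N) :=
  if C.Nonempty then paretoFrontier (latticeTimes τ C) else {⊤}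

theorem latticeFrontier_of_empty {N : ℕ} (τ : ℝ) {C : Set (Fin N → ℕ)} (hC : ¬ C.Nonempty) :
    latticeFrontier τ C = {⊤} := if_neg hC

theorem latticeFrontier_of_nonempty {N : ℕ} (τ : ℝ) {C : Set (Fin N → ℕ)} (hC : C.Nonempty) :
    latticeFrontier τ C = paretoFrontier (latticeTimes τ C) := if_pos hC

theorem exists_mem_latticeFrontier_le {N : ℕ} {τ : ℝ} (hτ : 0 < τ) {C : Set (Fin N → ℕ)}
    {c : Fin N → ℕ} (hc : c ∈ C) :
    ∃ t ∈ latticeFrontier τ C, t ≤ fun i => ENNReal.ofReal (τ * c i) := by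
  obtain ⟨b, hbc, hb⟩ := exists_minimal_le_of_wellFoundedLT (· ∈ C) c hc
  rw [latticeFrontier_of_nonempty τ ⟨c, hc⟩]
  refine ⟨_, ⟨⟨b, hb.prop, rfl⟩, ?_⟩, fun i => ?_⟩
  · rintro ⟨_, ⟨c', hc', rfl⟩, hne, hle⟩
    refine hne ?_
    have h1 : c' ≤ b := fun i => by
      have h2 := (ENNReal.ofReal_le_ofReal_iff (by positivity)).1 (hle i)
      exact_mod_cast le_of_mul_le_mul_left h2 hτ
    rw [h1.antisymm (hb.le_of_le hc' h1)]
  · have : (b i : ℝ) ≤ c i := by exact_mod_cast hbc i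
    exact ENNReal.ofReal_le_ofReal (by gcongr)

theorem latticeFrontier_nonempty {N : ℕ} {τ : ℝ} (hτ : 0 < τ) (C : Set (Fin N → ℕ)) :
    (latticeFrontier τ C).Nonempty := by
  by_cases hC : C.Nonempty
  · obtain ⟨c, hc⟩ := hC
    obtain ⟨t, ht, -⟩ := exists_mem_latticeFrontier_le hτ hc
    exact ⟨t, ht⟩
  · rw [latticeFrontier_of_empty τ hC]
    exact singleton_nonempty _

theorem mem_epiProfile_iff_of_eq_latticeFrontier {N d : ℕ} (hN : 0 < N) {τ : ℝ} (hτ : 0 < τ)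
    {Θ : JState N d → Set (TimeVec N)} {x : JState N d} {C : Set (Fin N → ℕ)}
    (h : Θ x = latticeFrontier τ C) (t : EuclideanSpace ℝ (Fin N)) :
    t ∈ epiProfile Θ x ↔ ∃ c ∈ C, ∀ i, τ * c i ≤ t i := by
  constructor
  · rintro ⟨t', ht', hle⟩
    rw [h] at ht'
    by_cases hC : C.Nonempty
    · rw [latticeFrontier_of_nonempty τ hC] at ht'
      obtain ⟨⟨c, hc, rfl⟩, -⟩ := ht'
      refine ⟨c, hc, fun i => ?_⟩
      have := (hle i).2
      rwa [ENNReal.toReal_ofReal (by positivity)] at this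
    · rw [latticeFrontier_of_empty τ hC, mem_singleton_iff] at ht'
      subst ht'
      exact absurd rfl (hle ⟨0, hN⟩).1
  · rintro ⟨c, hc, hle⟩
    obtain ⟨t', ht', hle'⟩ := exists_mem_latticeFrontier_le hτ hc
    refine ⟨t', h ▸ ht', fun i => ⟨ne_top_of_le_ne_top ENNReal.ofReal_ne_top (hle' i), ?_⟩⟩
    exact (ENNReal.toReal_le_of_le_ofReal (by positivity) (hle' i)).trans (hle i)

/-- With no robots the finiteness condition is vacuous and even the vector ⊤ contributes, so this
case is treated apart. -/
theorem epiProfile_eq_univ {d : ℕ} {Θ : JState 0 d → Set (TimeVec 0)} {x : JState 0 d}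
    (h : (Θ x).Nonempty) : epiProfile Θ x = univ := by
  obtain ⟨t, ht⟩ := h
  exact eq_univ_of_forall fun _ => ⟨t, ht, fun i => i.elim0⟩

/-! ### Counting steps on the grid -/

namespace Discretization

variable {N d : ℕ} {D : Discretization N d} {R : RobotTeam N d} {l : Fin N → ℝ} {p : ℕ}

/-- The shortest time step of a robot under way. -/
noncomputable def minStep (D : Discretization N d) (p : ℕ) : ℝ :=
  ⌈(D.ε p - 2 * D.h p) / D.h p⌉₊ * D.h p

theorem Admissible.le_minStep (hD : D.Admissible R) (p : ℕ) :
    D.ε p - 2 * D.h p ≤ D.minStep p := by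
  have := Nat.le_ceil ((D.ε p - 2 * D.h p) / D.h p)
  rwa [div_le_iff₀ (hD.h_pos p)] at this

theorem Admissible.minStep_pos (hD : D.Admissible R) (p : ℕ) : 0 < D.minStep p := by
  linarith [hD.le_minStep p, hD.two_h_lt p]

theorem Admissible.eps_pos (hD : D.Admissible R) (p : ℕ) : 0 < D.ε p := by
  linarith [hD.h_pos p, hD.two_h_lt p]

theorem Admissible.minStep_le (hD : D.Admissible R) (p : ℕ) : D.minStep p ≤ D.ε p := by
  have hh := hD.h_pos p
  have h1 := Nat.ceil_lt_add_one (a := (D.ε p - 2 * D.h p) / D.h p)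
    (div_nonneg (by linarith [hD.two_h_lt p]) hh.le)
  have h2 := mul_lt_mul_of_pos_right h1 hh
  rw [add_mul, div_mul_cancel₀ _ hh.ne'] at h2
  unfold minStep
  linarith

theorem Admissible.minStep_le_of_mem (hD : D.Admissible R) {τ : ℝ} (hτ : D.ε p - 2 * D.h p ≤ τ)
    {k : ℕ} (hk : τ = k * D.h p) : D.minStep p ≤ τ := by
  have hh := hD.h_pos p
  rw [hk] at hτ ⊢
  refine mul_le_mul_of_nonneg_right ?_ hh.le
  exact_mod_cast Nat.ceil_le.2 ((div_le_iff₀ hh).2 hτ)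

theorem Admissible.jointGrid_finite (hD : D.Admissible R) (p : ℕ) : (D.jointGrid p).Finite := by
  refine ((Set.Finite.pi' (hD.grid_finite p)).image (WithLp.toLp 2)).subset fun x hx => ?_
  exact ⟨fun i => x i, hx, rfl⟩

open Classical in
/-- `1` if robot `i` is under way, `0` if it rests. -/
noncomputable def moving (D : Discretization N d) (R : RobotTeam N d) (p : ℕ) (x : JState N d)
    (i : Fin N) : ℕ := if D.UnderWay R p i (x i) then 1 else 0

variable (D R l p) in
/-- One step of the Bellman operator on the level of step counts. -/
def stepCounts (C : JState N d → Set (Fin N → ℕ)) (x : JState N d) : Set (Fin N → ℕ) :=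
  {c | ∃ y ∈ D.succX R l p x, ∃ c' ∈ C y, ∀ i, c' i + D.moving R p x i ≤ c i}

variable (D R l p) in
/-- The vectors which bound the numbers of moves of the robots along some grid path with `n`
steps. -/
def counts : ℕ → JState N d → Set (Fin N → ℕ)
  | 0 => fun x => {_c | x ∈ D.safeGrid R p}
  | n + 1 => D.stepCounts R l p (counts n)

variable (D R l p) in
/-- The vectors which bound the numbers of moves of the robots for grid paths of any length. -/
def limitCounts (x : JState N d) : Set (Fin N → ℕ) := ⋂ n, D.counts R l p (n + 1) x

/-- Together with `moving_mem_succT` this says that the shortest steps form the least element of the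
admissible joint time steps. -/
theorem moving_mul_le (hD : D.Admissible R) {x : JState N d} {τ : Fin N → ℝ}
    (hτ : τ ∈ D.succT R p x) (i : Fin N) : D.minStep p * D.moving R p x i ≤ τ i := by
  obtain ⟨h1, k, hk⟩ := hτ i
  unfold stepT at h1
  unfold moving
  split_ifs at h1 ⊢ with hu
  · simpa using hD.minStep_le_of_mem h1.1 hk
  · rw [mem_singleton_iff] at h1
    simp [h1]

theorem moving_mem_succT (hD : D.Admissible R) (x : JState N d) :
    (fun i => D.minStep p * D.moving R p x i) ∈ D.succT R p x := by
  intro i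
  by_cases hu : D.UnderWay R p i (x i)
  · have h1 := hD.le_minStep p
    have h2 := hD.minStep_le p
    have h3 := hD.h_pos p
    simp only [moving, stepT, if_pos hu, Nat.cast_one, mul_one]
    exact ⟨⟨h1, by linarith⟩, _, rfl⟩
  · simp only [moving, stepT, if_neg hu]
    exact ⟨by simp, 0, by simp⟩

/-- Longer time steps are dominated by the shortest one, so the Bellman operator acts on frontiers
of lattice vectors through `stepCounts`. -/
theorem bellman_eq_latticeFrontier (hD : D.Admissible R) {Θ : JState N d → Set (TimeVec N)}
    {C : JState N d → Set (Fin N → ℕ)}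
    (h : ∀ y ∈ D.safeGrid R p, Θ y = latticeFrontier (D.minStep p) (C y)) (x : JState N d) :
    D.bellman R l p Θ x = latticeFrontier (D.minStep p) (D.stepCounts R l p C x) := by
  have hτ := hD.minStep_pos p
  by_cases hC : (D.stepCounts R l p C x).Nonempty
  · have hBA : ∀ b ∈ latticeTimes (D.minStep p) (D.stepCounts R l p C x),
        ∃ a ∈ D.candidates R l p Θ x, a ≤ b := by
      rintro _ ⟨c, ⟨y, hy, c', hc', hle⟩, rfl⟩
      obtain ⟨t', ht', hle'⟩ := exists_mem_latticeFrontier_le hτ hc'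
      rw [← h y hy.1] at ht'
      refine ⟨_, ⟨_, moving_mem_succT hD x, y, hy, t', ht', rfl⟩, fun i => ?_⟩
      refine (add_le_add_right (hle' i) _).trans ?_
      rw [← ENNReal.ofReal_add (by positivity) (by positivity)]
      refine ENNReal.ofReal_le_ofReal ?_
      have : (c' i : ℝ) + D.moving R p x i ≤ c i := by exact_mod_cast hle i
      nlinarith
    have hAB : ∀ a ∈ D.candidates R l p Θ x,
        ∃ b ∈ latticeTimes (D.minStep p) (D.stepCounts R l p C x), b ≤ a := by
      rintro _ ⟨τ, hτ', y, hy, t', ht', rfl⟩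
      rw [h y hy.1] at ht'
      by_cases hCy : (C y).Nonempty
      · rw [latticeFrontier_of_nonempty _ hCy] at ht'
        obtain ⟨⟨c', hc', rfl⟩, -⟩ := ht'
        refine ⟨_, ⟨fun i => c' i + D.moving R p x i, ⟨y, hy, c', hc', fun i => le_rfl⟩, rfl⟩,
          fun i => ?_⟩
        have h1 := moving_mul_le hD hτ' i
        dsimp only
        rw [← ENNReal.ofReal_add (le_trans (by positivity) h1) (by positivity)]
        refine ENNReal.ofReal_le_ofReal ?_
        push_cast
        linarith
      -- A successor of infinite value contributes only ⊤, which lies above every lattice vector.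
      · rw [latticeFrontier_of_empty _ hCy, mem_singleton_iff] at ht'
        obtain ⟨c, hc⟩ := hC
        exact ⟨_, ⟨c, hc, rfl⟩, fun i => by simp [ht']⟩
    have hne : (D.candidates R l p Θ x).Nonempty := by
      obtain ⟨c, hc⟩ := hC
      obtain ⟨a, ha, -⟩ := hBA _ ⟨c, hc, rfl⟩
      exact ⟨a, ha⟩
    rw [bellman, if_pos hne, latticeFrontier_of_nonempty _ hC]
    exact paretoFrontier_eq_of_dominated hAB hBA
  · rw [latticeFrontier_of_empty _ hC]
    have hsub : D.candidates R l p Θ x ⊆ {⊤} := by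
      rintro _ ⟨τ, -, y, hy, t', ht', rfl⟩
      have hCy : ¬ (C y).Nonempty := by
        rintro ⟨c', hc'⟩
        exact hC ⟨_, y, hy, c', hc', fun i => le_rfl⟩
      rw [h y hy.1, latticeFrontier_of_empty _ hCy, mem_singleton_iff] at ht'
      subst ht'
      exact funext fun i => by simp
    rw [bellman]
    split_ifs with hne
    · rw [hne.subset_singleton_iff.1 hsub, paretoFrontier_singleton]
    · rfl

theorem iter_eq_latticeFrontier (hD : D.Admissible R) (n : ℕ) (x : JState N d) :
    D.iter R l p n x = latticeFrontier (D.minStep p) (D.counts R l p n x) := by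
  induction n generalizing x with
  | zero =>
    have hτ := hD.minStep_pos p
    by_cases hx : x ∈ D.safeGrid R p
    · have hC : (D.counts R l p 0 x).Nonempty := ⟨0, hx⟩
      rw [latticeFrontier_of_nonempty _ hC, show D.iter R l p 0 x = {0} from if_pos hx,
        ← paretoFrontier_singleton]
      refine paretoFrontier_eq_of_dominated ?_ ?_
      · rintro _ rfl
        exact ⟨_, ⟨0, hx, rfl⟩, fun i => by simp⟩
      · rintro _ -
        exact ⟨0, rfl, zero_le⟩
    · have hC : ¬ (D.counts R l p 0 x).Nonempty := fun ⟨_, h⟩ => hx h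
      rw [latticeFrontier_of_empty _ hC, show D.iter R l p 0 x = {⊤} from if_neg hx]
  | succ n ih => exact bellman_eq_latticeFrontier hD (fun y _ => ih y) x

theorem isUpperSet_counts (n : ℕ) (x : JState N d) : IsUpperSet (D.counts R l p n x) := by
  cases n with
  | zero => exact fun _ _ _ h => h
  | succ n =>
    rintro c c₁ hle ⟨y, hy, c', hc', h⟩
    exact ⟨y, hy, c', hc', fun i => (h i).trans (hle i)⟩

theorem counts_succ_subset (n : ℕ) {x : JState N d} (hx : x ∈ D.safeGrid R p) :
    D.counts R l p (n + 1) x ⊆ D.counts R l p n x := by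
  induction n generalizing x with
  | zero => exact fun _ _ => hx
  | succ n ih =>
    rintro c ⟨y, hy, c', hc', h⟩
    exact ⟨y, hy, c', ih hy.1 hc', h⟩

theorem antitone_counts {x : JState N d} (hx : x ∈ D.safeGrid R p) :
    Antitone fun n => D.counts R l p n x :=
  antitone_nat_of_succ_le fun n => counts_succ_subset n hx

/-- Off the safe grid the counts are empty at index 0 but may be non-empty at index 1, since only
successors must be safe. Hence the monotonicity, and the intersection in `limitCounts`, start at
index 1. -/
theorem antitone_counts_succ (x : JState N d) : Antitone fun n => D.counts R l p (n + 1) x := by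
  rintro m n hmn c ⟨y, hy, c', hc', h⟩
  exact ⟨y, hy, c', antitone_counts hy.1 hmn hc', h⟩

/-- Existence of a successor commutes with the decreasing intersection because successors are
finitely many: if each of them failed at some level, all would fail at a common one. -/
theorem stepCounts_limitCounts (hD : D.Admissible R) (x : JState N d) :
    D.stepCounts R l p (D.limitCounts R l p) x = D.limitCounts R l p x := by
  ext c
  constructor
  · rintro ⟨y, hy, c', hc', h⟩
    refine mem_iInter.2 fun n => ⟨y, hy, c', ?_, h⟩
    cases n with
    | zero => exact hy.1
    | succ n => exact mem_iInter.1 hc' n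
  · intro hc
    by_contra hn
    have hex : ∀ y ∈ D.succX R l p x, (∀ i, D.moving R p x i ≤ c i) →
        ∃ n, (fun i => c i - D.moving R p x i) ∉ D.counts R l p n y := by
      intro y hy hle
      by_contra! hall
      exact hn ⟨y, hy, _, mem_iInter.2 fun n => hall (n + 1),
        fun i => (Nat.sub_add_cancel (hle i)).le⟩
    choose! n hn' using hex
    have hfin : (D.succX R l p x).Finite := (hD.jointGrid_finite p).subset fun y hy => hy.1.1
    obtain ⟨m, hm⟩ := (hfin.image n).bddAbove
    obtain ⟨y, hy, c', hc', h⟩ := mem_iInter.1 hc m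
    refine hn' y hy (fun i => (Nat.le_add_left _ _).trans (h i)) ?_
    refine antitone_counts hy.1 (hm (mem_image_of_mem n hy)) ?_
    exact isUpperSet_counts m y (fun i => Nat.le_sub_of_add_le (h i)) hc'

/-- The epigraphical limit of the value iteration on the level of step counts. -/
theorem isKuratowskiLimit_counts (hD : D.Admissible R) (x : JState N d) :
    IsKuratowskiLimit
      (fun n => {t : EuclideanSpace ℝ (Fin N) |
        ∃ c ∈ D.counts R l p n x, ∀ i, D.minStep p * c i ≤ t i})
      {t | ∃ c ∈ D.limitCounts R l p x, ∀ i, D.minStep p * c i ≤ t i} := by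
  have hτ := hD.minStep_pos p
  refine IsKuratowskiLimit.of_subset ?_ ?_
  · rintro t ⟨c, hc, hle⟩
    refine mem_kuratowskiLiminf_of_eventually_mem ?_
    filter_upwards [eventually_ge_atTop 1] with n hn
    obtain ⟨n, rfl⟩ := Nat.exists_eq_add_of_le' hn
    exact ⟨c, mem_iInter.1 hc n, hle⟩
  · intro t ht
    -- k is the largest integer vector with `minStep` · k ≤ t. Near t no larger count fits, so k
    -- itself belongs to the upper sets of counts infinitely often, hence always from index 1 on.
    let k : Fin N → ℤ := fun i => ⌊t i / D.minStep p⌋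
    have hV : {a : EuclideanSpace ℝ (Fin N) | ∀ i, a i < D.minStep p * (k i + 1)} ∈ 𝓝 t := by
      have ho : IsOpen {a : EuclideanSpace ℝ (Fin N) | ∀ i, a i < D.minStep p * (k i + 1)} := by
        simp only [ofPred_forall]
        exact isOpen_iInter_of_finite fun i => isOpen_lt (by fun_prop) continuous_const
      refine ho.mem_nhds fun i => ?_
      have := Int.lt_floor_add_one (t i / D.minStep p)
      rwa [div_lt_iff₀' hτ] at this
    have hfr := frequently_inter_nonempty_of_mem_kuratowskiLimsup ht hV
    have hfr' : ∃ᶠ n in atTop, (∀ i, 0 ≤ k i) ∧ (fun i => (k i).toNat) ∈ D.counts R l p n x := by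
      refine hfr.mono ?_
      rintro n ⟨a, ⟨c, hc, hle⟩, ha⟩
      have hck : ∀ i, (c i : ℤ) ≤ k i := fun i => by
        have h1 : (c i : ℝ) < k i + 1 := lt_of_mul_lt_mul_left ((hle i).trans_lt (ha i)) hτ.le
        have h2 : (c i : ℤ) < k i + 1 := by exact_mod_cast h1
        omega
      exact ⟨fun i => (Int.natCast_nonneg _).trans (hck i),
        isUpperSet_counts n x (fun i =>
          (Int.le_toNat ((Int.natCast_nonneg _).trans (hck i))).2 (hck i)) hc⟩
    obtain ⟨-, hk0, -⟩ := hfr'.exists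
    refine ⟨fun i => (k i).toNat, mem_iInter.2 fun n => ?_, fun i => ?_⟩
    · obtain ⟨m, hm, -, hmem⟩ := frequently_atTop.1 hfr' (n + 1)
      obtain ⟨m, rfl⟩ := Nat.exists_eq_add_of_le' (Nat.le_of_add_left_le hm)
      exact antitone_counts_succ x (by omega) hmem
    · have h1 : (((k i).toNat : ℤ) : ℝ) = k i := by rw [Int.toNat_of_nonneg (hk0 i)]
      rw [← Int.cast_natCast, h1]
      have := Int.floor_le (t i / D.minStep p)
      rwa [le_div_iff₀' hτ] at this

theorem isKuratowskiLimit_epiProfile_iter (hD : D.Admissible R) (x : JState N d) :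
    IsKuratowskiLimit (fun n => epiProfile (D.iter R l p n) x)
      (epiProfile (fun x => latticeFrontier (D.minStep p) (D.limitCounts R l p x)) x) := by
  have hτ := hD.minStep_pos p
  rcases Nat.eq_zero_or_pos N with rfl | hN
  · have h1 : ∀ n, epiProfile (D.iter R l p n) x = univ := fun n => epiProfile_eq_univ (by
      rw [iter_eq_latticeFrontier hD]
      exact latticeFrontier_nonempty hτ _)
    simp only [h1]
    rw [epiProfile_eq_univ (latticeFrontier_nonempty hτ _)]
    exact .of_subset
      (fun _ _ => mem_kuratowskiLiminf_of_eventually_mem (.of_forall fun _ => mem_univ _))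
      (subset_univ _)
  · convert isKuratowskiLimit_counts (l := l) (p := p) hD x using 1
    · funext n
      ext t
      exact mem_epiProfile_iff_of_eq_latticeFrontier hN hτ (iter_eq_latticeFrontier hD n x) t
    · ext t
      exact mem_epiProfile_iff_of_eq_latticeFrontier hN hτ rfl t

theorem isValueLimit_latticeFrontier (hD : D.Admissible R) :
    D.IsValueLimit R l p fun x => latticeFrontier (D.minStep p) (D.limitCounts R l p x) where
  fixed x _ := by
    rw [bellman_eq_latticeFrontier hD (fun _ _ => rfl) x, stepCounts_limitCounts hD]
  limit x _ := isKuratowskiLimit_epiProfile_iter hD x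

theorem IsValueLimit.epiProfile_eq (hD : D.Admissible R) {Θ : JState N d → Set (TimeVec N)}
    (hΘ : D.IsValueLimit R l p Θ) {x : JState N d} (hx : x ∈ D.jointGrid p) :
    epiProfile Θ x =
      epiProfile (fun x => latticeFrontier (D.minStep p) (D.limitCounts R l p x)) x :=
  (hΘ.limit x hx).1.symm.trans (isKuratowskiLimit_epiProfile_iter hD x).1

theorem IsValueLimit.mem_epiProfile_iff (hD : D.Admissible R) (hN : 0 < N)
    {Θ : JState N d → Set (TimeVec N)} (hΘ : D.IsValueLimit R l p Θ) {x : JState N d}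
    (hx : x ∈ D.jointGrid p) (t : EuclideanSpace ℝ (Fin N)) :
    t ∈ epiProfile Θ x ↔ ∃ c ∈ D.limitCounts R l p x, ∀ i, D.minStep p * c i ≤ t i := by
  rw [hΘ.epiProfile_eq hD hx]
  exact mem_epiProfile_iff_of_eq_latticeFrontier hN (hD.minStep_pos p) rfl t

/-- Step counts for paths of any length are those of infinite paths. -/
theorem mem_limitCounts_iff (hD : D.Admissible R) {x : JState N d} {c : Fin N → ℕ} :
    c ∈ D.limitCounts R l p x ↔ ∃ (z : ℕ → JState N d) (b : ℕ → Fin N → ℕ), z 0 = x ∧ b 0 = c ∧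
      (∀ j, z (j + 1) ∈ D.succX R l p (z j)) ∧
      ∀ j i, b (j + 1) i + D.moving R p (z j) i ≤ b j i := by
  constructor
  · intro hc
    have hstep : ∀ q : {q : JState N d × (Fin N → ℕ) // q.2 ∈ D.limitCounts R l p q.1},
        ∃ q' : {q : JState N d × (Fin N → ℕ) // q.2 ∈ D.limitCounts R l p q.1},
          q'.1.1 ∈ D.succX R l p q.1.1 ∧
          ∀ i, q'.1.2 i + D.moving R p q.1.1 i ≤ q.1.2 i := by
      rintro ⟨⟨x, c⟩, hc⟩
      rw [← stepCounts_limitCounts hD] at hc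
      obtain ⟨y, hy, c', hc', h⟩ := hc
      exact ⟨⟨⟨y, c'⟩, hc'⟩, hy, h⟩
    choose g hg1 hg2 using hstep
    let s : ℕ → {q : JState N d × (Fin N → ℕ) // q.2 ∈ D.limitCounts R l p q.1} := fun j =>
      Nat.rec ⟨⟨x, c⟩, hc⟩ (fun _ q => g q) j
    exact ⟨fun j => (s j).1.1, fun j => (s j).1.2, rfl, rfl, fun j => hg1 (s j),
      fun j => hg2 (s j)⟩
  · rintro ⟨z, b, rfl, rfl, h1, h2⟩
    have : ∀ n j, b j ∈ D.counts R l p (n + 1) (z j) := by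
      intro n
      induction n with
      | zero => exact fun j => ⟨z (j + 1), h1 j, b (j + 1), (h1 j).1, h2 j⟩
      | succ n ih => exact fun j => ⟨z (j + 1), h1 j, b (j + 1), ih (j + 1), h2 j⟩
    exact mem_iInter.2 fun n => this n 0

end Discretization

namespace Discretization

variable {N d : ℕ} {D : Discretization N d} {R : RobotTeam N d} {l : Fin N → ℝ} {p : ℕ}

/-! ### Grid paths are approximate arcs -/

theorem α_nonneg (hD : D.Admissible R) (p : ℕ) : 0 ≤ D.α R l p := by
  have h1 := hD.h_pos p
  have h2 := hD.eps_pos p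
  have h3 : 0 ≤ R.Mplus := Real.sqrt_nonneg _
  unfold α
  positivity

theorem exists_velocity_of_mem_stepX (hreg : R.Regular l) (hD : D.Admissible R) {i : Fin N}
    {x y : RState d} (hx : x ∈ R.X i) (hu : D.UnderWay R p i x) (hy : y ∈ D.stepX R l p i x) :
    ∃ v ∈ R.F i x, ‖y - x - D.ε p • v‖ ≤ D.α R l p := by
  rw [stepX, if_pos hu] at hy
  have hc : IsCompact ((fun v => x + D.ε p • v) '' R.F i x) :=
    (hreg.F_compact hx).image (by fun_prop)
  obtain ⟨_, ⟨v, hv, rfl⟩, he⟩ := hc.exists_infEDist_eq_edist ((hreg.F_nonempty i x).image _) y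
  refine ⟨v, hv, ?_⟩
  have h := hy.2
  rw [he, edist_dist, ENNReal.ofReal_le_ofReal_iff (α_nonneg hD p), dist_eq_norm] at h
  rwa [sub_sub]

/-- Increments along `m` steps of a robot under way. -/
theorem exists_velocity_of_steps (hreg : R.Regular l) (hD : D.Admissible R) {i : Fin N}
    {z : ℕ → RState d} {κ : ℕ} (hX : ∀ j, z j ∈ R.X i)
    (hz : ∀ j < κ, D.UnderWay R p i (z j) ∧ z (j + 1) ∈ D.stepX R l p i (z j)) (j m : ℕ)
    (hm : j + m ≤ κ) :
    ‖z (j + m) - z j‖ ≤ m * (R.M i * D.ε p + D.α R l p) ∧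
    ∃ v ∈ R.F i (z j), ‖z (j + m) - z j - (m * D.ε p) • v‖ ≤
      m * D.α R l p + l i * D.ε p * (R.M i * D.ε p + D.α R l p) * m ^ 2 := by
  have hε := hD.eps_pos p
  have hα : 0 ≤ D.α R l p := α_nonneg hD p
  have hl := hreg.l_nonneg i
  have hM := R.M_nonneg i
  induction m with
  | zero =>
    obtain ⟨v, hv⟩ := hreg.F_nonempty i (z j)
    exact ⟨by simp, v, hv, by simp⟩
  | succ m ih =>
    obtain ⟨h1, v, hv, h2⟩ := ih (by omega)
    obtain ⟨hu, hs⟩ := hz (j + m) (by omega)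
    obtain ⟨w', hw', h3⟩ := exists_velocity_of_mem_stepX hreg hD (hX _) hu hs
    obtain ⟨w, hw, h4⟩ := hreg.F_lipschitz i _ (hX (j + m)) _ (hX j) _ hw'
    have h5 := hreg.norm_le_M (hX (j + m)) hw'
    rw [← add_assoc]
    push_cast
    have hm1 : (0 : ℝ) < m + 1 := by positivity
    -- The new mean velocity averages the old one with the last velocity transported to z j;
    -- convexity keeps it in F.
    refine ⟨?_, ((m : ℝ) / (m + 1)) • v + ((1 : ℝ) / (m + 1)) • w,
      hreg.F_convex i _ (hX j) hv hw (by positivity) (by positivity) (by field_simp), ?_⟩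
    · have e : z (j + m + 1) - z j =
          (z (j + m + 1) - z (j + m) - D.ε p • w') + D.ε p • w' + (z (j + m) - z j) := by abel
      rw [e]
      refine norm_add₃_le.trans ?_
      rw [norm_smul, Real.norm_of_nonneg hε.le]
      nlinarith [mul_le_mul_of_nonneg_left h5 hε.le]
    · have e1 : ((m + 1 : ℝ) * D.ε p) • (((m : ℝ) / (m + 1)) • v + ((1 : ℝ) / (m + 1)) • w) =
          (m * D.ε p) • v + D.ε p • w := by
        rw [smul_add, smul_smul, smul_smul]
        congr 2 <;> field_simp
      have e : z (j + m + 1) - z j - ((m * D.ε p) • v + D.ε p • w) =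
          (z (j + m + 1) - z (j + m) - D.ε p • w') + D.ε p • (w' - w) +
            (z (j + m) - z j - (m * D.ε p) • v) := by
        rw [smul_sub]; abel
      rw [e1, e]
      refine norm_add₃_le.trans ?_
      rw [norm_smul, Real.norm_of_nonneg hε.le]
      have h6 : D.ε p * ‖w' - w‖ ≤ D.ε p * (l i * (m * (R.M i * D.ε p + D.α R l p))) :=
        mul_le_mul_of_nonneg_left (h4.trans (mul_le_mul_of_nonneg_left h1 hl)) hε.le
      have h7 : 0 ≤ l i * D.ε p * (R.M i * D.ε p + D.α R l p) * (m + 1) := by positivity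
      nlinarith

variable (D R l p) in
/-- The accuracy to which grid paths are arcs. -/
noncomputable def pathError : ℝ :=
  Real.sqrt (∑ i, l i ^ 2) * R.Mplus * (2 * D.ε p + D.ε p ^ 2)
    + Real.sqrt (∑ i, l i ^ 2) * (D.α R l p / D.ε p) * (2 + 2 * D.ε p ^ 2)
    + D.α R l p / D.ε p * (1 + D.ε p) + 2 * D.ε p * R.Mplus + 2 * D.h p

theorem Admissible.h_tendsto (hD : D.Admissible R) : Tendsto D.h atTop (𝓝 0) :=
  squeeze_zero (fun p => (hD.h_pos p).le)
    (fun p => by linarith [hD.two_h_lt p, hD.h_pos p]) hD.eps_tendsto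

/-- The decisive quotient is α/ε = 2 h/ε + h l⁺ + ε l⁺M⁺, which vanishes because h/ε does. -/
theorem tendsto_pathError (hD : D.Admissible R) :
    Tendsto (D.pathError R l) atTop (𝓝 0) := by
  have hε := hD.eps_tendsto
  have hh := hD.h_tendsto
  have hβ : Tendsto (fun p => D.α R l p / D.ε p) atTop (𝓝 0) := by
    have h1 : (fun p => D.α R l p / D.ε p) = fun p => 2 * (D.h p / D.ε p) +
        D.h p * Real.sqrt (∑ i, l i ^ 2) + D.ε p * (Real.sqrt (∑ i, l i ^ 2) * R.Mplus) := by
      funext p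
      have := (hD.eps_pos p).ne'
      unfold α
      field_simp
    rw [h1]
    simpa using ((hD.ratio_tendsto.const_mul 2).add (hh.mul_const (Real.sqrt (∑ i, l i ^ 2)))).add
      (hε.mul_const (Real.sqrt (∑ i, l i ^ 2) * R.Mplus))
  unfold pathError
  have := ((((((hε.const_mul 2).add (hε.pow 2)).const_mul
    (Real.sqrt (∑ i, l i ^ 2) * R.Mplus)).add
    ((hβ.const_mul (Real.sqrt (∑ i, l i ^ 2))).mul (((hε.pow 2).const_mul 2).const_add 2))).add
    (hβ.mul (hε.const_add 1))).add ((hε.const_mul 2).mul_const R.Mplus)).add (hh.const_mul 2)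
  simpa using this

theorem exists_goal_of_not_underWay (hD : D.Admissible R) {i : Fin N} {x : RState d}
    (hu : ¬ D.UnderWay R p i x) {r : ℝ} (hr : R.M i * D.ε p + D.h p < r) :
    ∃ g ∈ R.XG i, ‖x - g‖ < r := by
  have h0 : 0 < r := lt_of_le_of_lt (add_nonneg (mul_nonneg (R.M_nonneg i) (hD.eps_pos p).le)
    (hD.h_pos p).le) hr
  have h1 : Metric.infEDist x (R.XG i) < ENNReal.ofReal r :=
    (not_lt.1 hu).trans_lt ((ENNReal.ofReal_lt_ofReal_iff h0).2 hr)
  obtain ⟨g, hg, hlt⟩ := Metric.infEDist_lt_iff.1 h1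
  rw [edist_dist, ENNReal.ofReal_lt_ofReal_iff h0, dist_eq_norm] at hlt
  exact ⟨g, hg, hlt⟩

theorem isApproxArc_of_path (hreg : R.Regular l) (hD : D.Admissible R) {i : Fin N}
    {z : ℕ → RState d} {κ : ℕ} (hX : ∀ j, z j ∈ R.X i)
    (hz : ∀ j < κ, D.UnderWay R p i (z j) ∧ z (j + 1) ∈ D.stepX R l p i (z j))
    (hκ : ¬ D.UnderWay R p i (z κ)) (hrest : ∀ j, κ ≤ j → z j = z κ) :
    R.IsApproxArc l i (D.pathError R l p) (fun s => z ⌊s / D.ε p⌋₊) (κ * D.ε p) := by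
  have hε := hD.eps_pos p
  have hh := hD.h_pos p
  have hl := hreg.l_nonneg i
  have hM := R.M_nonneg i
  have hM' := R.M_le_Mplus i
  have hl' := RobotTeam.le_sqrt_sum_sq l i
  have hα : 0 ≤ D.α R l p := α_nonneg hD p
  set L := Real.sqrt (∑ i, l i ^ 2) with hL
  have hL0 : 0 ≤ L := hl.trans hl'
  have hP0 : 0 ≤ R.Mplus := hM.trans hM'
  set ε := D.ε p with hεdef
  obtain ⟨β, hβ⟩ : ∃ β, β = D.α R l p / ε := ⟨_, rfl⟩
  have hβ0 : 0 ≤ β := hβ ▸ div_nonneg hα hε.le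
  have hαβ : D.α R l p = β * ε := by rw [hβ, div_mul_cancel₀ _ hε.ne']
  have herr : D.pathError R l p = L * R.Mplus * (2 * ε + ε ^ 2) + L * β * (2 + 2 * ε ^ 2) +
      β * (1 + ε) + 2 * ε * R.Mplus + 2 * D.h p := by rw [pathError, ← hL, ← hεdef, ← hβ]
  have hLM : l i * R.M i ≤ L * R.Mplus := mul_le_mul hl' hM' hM hL0
  have hLM0 : 0 ≤ l i * R.M i := mul_nonneg hl hM
  have hLβ : l i * β ≤ L * β := mul_le_mul_of_nonneg_right hl' hβ0
  have hMε : R.M i * ε ≤ ε * R.Mplus := by rw [mul_comm]; exact mul_le_mul_of_nonneg_left hM' hε.le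
  have q1 : 0 ≤ L * R.Mplus := mul_nonneg hL0 hP0
  have q2 : 0 ≤ L * β := mul_nonneg hL0 hβ0
  have q3 : 0 ≤ ε * R.Mplus := mul_nonneg hε.le hP0
  have q4 : 0 ≤ β * ε := mul_nonneg hβ0 hε.le
  have q5 : 0 ≤ L * R.Mplus * ε := mul_nonneg q1 hε.le
  have q6 : 0 ≤ L * R.Mplus * ε ^ 2 := mul_nonneg q1 (sq_nonneg _)
  have q7 : 0 ≤ L * β * ε ^ 2 := mul_nonneg q2 (sq_nonneg _)
  have q8 : l i * R.M i * ε ≤ L * R.Mplus * ε := mul_le_mul_of_nonneg_right hLM hε.le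
  have q9 : l i * R.M i * ε ^ 2 ≤ L * R.Mplus * ε ^ 2 :=
    mul_le_mul_of_nonneg_right hLM (sq_nonneg _)
  have q10 : l i * β * ε ^ 2 ≤ L * β * ε ^ 2 := mul_le_mul_of_nonneg_right hLβ (sq_nonneg _)
  -- `hE1` and `hE2` serve the Lipschitz bound, `hE3`, `hE4` and `hE5` the constant, linear and
  -- quadratic coefficients of the increment error, and `hE6` the distance to the goal.
  have hE1 : R.M i * ε + β * ε ≤ D.pathError R l p := by rw [herr]; linarith
  have hE2 : β ≤ D.pathError R l p := by rw [herr]; linarith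
  have hE3 : ε * β + l i * R.M i * ε ^ 2 + 2 * (l i * β) * ε ^ 2 + ε * R.M i ≤
      D.pathError R l p := by rw [herr]; linarith
  have hE4 : β + 2 * (l i * R.M i * ε) ≤ D.pathError R l p := by rw [herr]; linarith
  have hE5 : 2 * (l i * β) ≤ D.pathError R l p := by rw [herr]; linarith
  have hE6 : R.M i * ε + 2 * D.h p ≤ D.pathError R l p := by rw [herr]; linarith
  clear herr
  generalize D.pathError R l p = E at *
  have hfl : ∀ s s', 0 ≤ s → s ≤ s' → ∃ m : ℕ, ⌊s' / ε⌋₊ = ⌊s / ε⌋₊ + m ∧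
      m * ε ≤ (s' - s) + ε ∧ |m * ε - (s' - s)| ≤ ε := by
    intro s s' hs hss
    obtain ⟨m, hm⟩ := Nat.exists_eq_add_of_le
      (Nat.floor_le_floor (div_le_div_of_nonneg_right hss hε.le))
    have a1 := Nat.floor_le (div_nonneg hs hε.le)
    have a2 := Nat.lt_floor_add_one (s / ε)
    have a3 := Nat.floor_le (div_nonneg (hs.trans hss) hε.le)
    have a4 := Nat.lt_floor_add_one (s' / ε)
    rw [hm] at a3 a4
    push_cast at a3 a4
    rw [le_div_iff₀ hε] at a1 a3
    rw [div_lt_iff₀ hε] at a2 a4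
    refine ⟨m, hm, by linarith, abs_le.2 ⟨by linarith, by linarith⟩⟩
  have hmin : ∀ j, z j = z (min j κ) := fun j => by
    rcases le_total j κ with h | h
    · rw [min_eq_left h]
    · rw [min_eq_right h, hrest j h]
  have hfloor : ⌊κ * ε / ε⌋₊ = κ := by rw [mul_div_cancel_right₀ _ hε.ne', Nat.floor_natCast]
  refine ⟨by positivity, fun s _ => hX _, fun s s' hs hss => ?_, fun s s' hs hss hsT => ?_,
    fun s hs => ?_, ?_⟩
  · obtain ⟨m, hm, hm1, -⟩ := hfl s s' hs hss
    rw [hm, hmin (_ + m), hmin ⌊s / ε⌋₊]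
    obtain ⟨m', hm'⟩ := Nat.exists_eq_add_of_le
      (min_le_min_right κ (Nat.le_add_right ⌊s / ε⌋₊ m))
    have hmm : m' ≤ m := by omega
    have hmm' : (m' : ℝ) ≤ m := by exact_mod_cast hmm
    have h1 := (exists_velocity_of_steps hreg hD hX hz (min ⌊s / ε⌋₊ κ) m' (by omega)).1
    rw [hm']
    refine h1.trans ?_
    rw [← hεdef, hαβ]
    have hδ : 0 ≤ s' - s := sub_nonneg.2 hss
    have b1 : m' * (R.M i * ε + β * ε) ≤ (s' - s + ε) * (R.M i + β) := by
      have : (m' : ℝ) * ε ≤ s' - s + ε := (mul_le_mul_of_nonneg_right hmm' hε.le).trans hm1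
      linarith [mul_le_mul_of_nonneg_right this (add_nonneg hM hβ0)]
    refine b1.trans ?_
    have b2 : (s' - s + ε) * (R.M i + β) = R.M i * (s' - s) +
        ((R.M i * ε + β * ε) + β * (s' - s)) := by ring
    rw [b2, add_le_add_iff_left]
    linarith [mul_le_mul_of_nonneg_right hE2 hδ]
  · obtain ⟨m, hm, hm1, hm2⟩ := hfl s s' hs hss
    have hle : ⌊s / ε⌋₊ + m ≤ κ := by
      rw [← hm, ← hfloor]
      exact Nat.floor_le_floor (div_le_div_of_nonneg_right hsT hε.le)
    obtain ⟨-, v, hv, h1⟩ := exists_velocity_of_steps hreg hD hX hz ⌊s / ε⌋₊ m hle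
    refine ⟨v, hv, ?_⟩
    rw [hm]
    have e : z (⌊s / ε⌋₊ + m) - z ⌊s / ε⌋₊ - (s' - s) • v =
        (z (⌊s / ε⌋₊ + m) - z ⌊s / ε⌋₊ - (m * ε) • v) + (m * ε - (s' - s)) • v := by
      rw [sub_smul (m * ε)]; abel
    rw [e]
    refine (norm_add_le _ _).trans ?_
    have hδ : 0 ≤ s' - s := sub_nonneg.2 hss
    obtain ⟨δ, hδdef⟩ : ∃ δ, δ = s' - s := ⟨_, rfl⟩
    rw [← hδdef] at hδ hm1 hm2 ⊢
    have b0 : ‖(m * ε - δ) • v‖ ≤ ε * R.M i := by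
      rw [norm_smul, Real.norm_eq_abs]
      exact mul_le_mul hm2 (hreg.norm_le_M (hX _) hv) (norm_nonneg _) hε.le
    refine (add_le_add h1 b0).trans ?_
    rw [← hεdef, hαβ]
    have c1 : (m : ℝ) * ε * β ≤ (δ + ε) * β := mul_le_mul_of_nonneg_right hm1 hβ0
    have c2 : ((m : ℝ) * ε) ^ 2 ≤ (δ + ε) ^ 2 := pow_le_pow_left₀ (by positivity) hm1 2
    have c3 : l i * ε * (R.M i * ε + β * ε) * m ^ 2 ≤ (l i * R.M i + l i * β) * (δ + ε) ^ 2 := by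
      have : l i * ε * (R.M i * ε + β * ε) * m ^ 2 =
        (l i * R.M i + l i * β) * ((m : ℝ) * ε) ^ 2 := by ring
      rw [this]
      exact mul_le_mul_of_nonneg_left c2 (add_nonneg hLM0 (mul_nonneg hl hβ0))
    have c4 : l i * β * (δ + ε) ^ 2 ≤ l i * β * (2 * δ ^ 2 + 2 * ε ^ 2) :=
      mul_le_mul_of_nonneg_left (by nlinarith [sq_nonneg (δ - ε)]) (mul_nonneg hl hβ0)
    linarith [mul_le_mul_of_nonneg_right hE4 hδ, mul_le_mul_of_nonneg_right hE5 (sq_nonneg δ)]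
  · rw [hfloor, hrest]
    exact Nat.le_floor ((le_div_iff₀ hε).2 hs)
  · rw [hfloor]
    obtain ⟨g, hg, hlt⟩ := exists_goal_of_not_underWay hD hκ (r := R.M i * ε + 2 * D.h p)
      (by linarith)
    exact ⟨g, hg, hlt.le.trans hE6⟩

theorem stepX_of_not_underWay {i : Fin N} {x : RState d} (hu : ¬ D.UnderWay R p i x) :
    D.stepX R l p i x = {x} := if_neg hu

theorem exists_approxArc_of_mem_limitCounts (hreg : R.Regular l) (hD : D.Admissible R)
    {x : JState N d} (hx : x ∈ D.jointGrid p) {c : Fin N → ℕ}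
    (hc : c ∈ D.limitCounts R l p x) :
    ∃ (y : ℝ → JState N d) (κ : Fin N → ℕ), κ ≤ c ∧ y 0 = x ∧
      (∀ i, R.IsApproxArc l i (D.pathError R l p) (fun s => y s i) (κ i * D.ε p)) ∧
      ∀ s, D.ε p ≤ s → ∃ q ∈ R.safe, ‖y s - q‖ ≤ D.pathError R l p := by
  classical
  obtain ⟨z, b, rfl, rfl, hz, hb⟩ := (mem_limitCounts_iff hD).1 hc
  have hε := hD.eps_pos p
  -- Each move spends one unit of the budget, so robot i stops being under way after at most b 0 i
  -- moves.
  have hcount : ∀ i j, (∀ j' < j, D.UnderWay R p i (z j' i)) → b j i + j ≤ b 0 i := by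
    intro i j
    induction j with
    | zero => simp
    | succ j ih =>
      intro h
      have h1 := ih fun j' hj' => h j' (by omega)
      have h2 := hb j i
      rw [moving, if_pos (h j (by omega))] at h2
      omega
  have hex : ∀ i, ∃ j, ¬ D.UnderWay R p i (z j i) := by
    intro i
    by_contra! hall
    have := hcount i (b 0 i + 1) fun j _ => hall j
    omega
  have hgrid : ∀ j, z j ∈ D.jointGrid p := fun j => by
    cases j with
    | zero => exact hx
    | succ j => exact (hz j).1.1
  refine ⟨fun s => z ⌊s / D.ε p⌋₊, fun i => Nat.find (hex i), fun i => ?_, by simp, fun i => ?_,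
    fun s hs => ?_⟩
  · have := hcount i (Nat.find (hex i)) fun j hj => not_not.1 (Nat.find_min (hex i) hj)
    dsimp only
    omega
  · refine isApproxArc_of_path (z := fun j => z j i) hreg hD
      (fun j => hD.grid_subset p i (hgrid j i))
      (fun j hj => ⟨not_not.1 (Nat.find_min (hex i) hj), (hz j).2 i⟩) (Nat.find_spec (hex i)) ?_
    intro j hj
    induction j, hj using Nat.le_induction with
    | base => rfl
    | succ j hj ih =>
      dsimp only at ih ⊢
      have h1 := (hz j).2 i
      have h2 : ¬ D.UnderWay R p i (z j i) := by rw [ih]; exact Nat.find_spec (hex i)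
      rw [stepX_of_not_underWay h2, mem_singleton_iff] at h1
      rw [h1, ih]
  -- From time ε on the path has left its starting point and sits at a successor, which is on the
  -- safe grid.
  · have h1 : 1 ≤ ⌊s / D.ε p⌋₊ := Nat.le_floor (by rw [Nat.cast_one, le_div_iff₀ hε]; linarith)
    obtain ⟨j, hj⟩ := Nat.exists_eq_add_of_le' h1
    have h2 := (hz j).1.2
    have hh := hD.h_pos p
    have h3 : Metric.infEDist (z (j + 1)) R.safe < ENNReal.ofReal (2 * D.h p) :=
      h2.trans_lt ((ENNReal.ofReal_lt_ofReal_iff (by linarith)).2 (by linarith))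
    obtain ⟨q, hq, hlt⟩ := Metric.infEDist_lt_iff.1 h3
    rw [edist_dist, ENNReal.ofReal_lt_ofReal_iff (by linarith), dist_eq_norm] at hlt
    dsimp only
    rw [hj]
    refine ⟨q, hq, hlt.le.trans ?_⟩
    have hα : 0 ≤ D.α R l p := α_nonneg hD p
    have hP0 : 0 ≤ R.Mplus := Real.sqrt_nonneg _
    have : 0 ≤ Real.sqrt (∑ i, l i ^ 2) * R.Mplus * (2 * D.ε p + D.ε p ^ 2)
      + Real.sqrt (∑ i, l i ^ 2) * (D.α R l p / D.ε p) * (2 + 2 * D.ε p ^ 2)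
      + D.α R l p / D.ε p * (1 + D.ε p) + 2 * D.ε p * R.Mplus := by positivity
    unfold pathError
    linarith

end Discretization

namespace Discretization

variable {N d : ℕ} {D : Discretization N d} {R : RobotTeam N d} {l : Fin N → ℝ} {p : ℕ}

/-! ### Convergence -/

/-- Limits of arrival times on the grids are arrival times. -/
theorem exists_reachTimes_of_limit (hreg : R.Regular l) (hR : R.WellPosed) (hD : D.Admissible R)
    {φ : ℕ → ℕ} (hφ : Tendsto φ atTop atTop) {x : JState N d} {x' : ℕ → JState N d}
    (hx' : ∀ n, x' n ∈ D.jointGrid (φ n)) (hx : Tendsto x' atTop (𝓝 x))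
    {t : EuclideanSpace ℝ (Fin N)} {t' : ℕ → EuclideanSpace ℝ (Fin N)}
    (ht : Tendsto t' atTop (𝓝 t))
    (hmem : ∀ n, ∃ c ∈ D.limitCounts R l (φ n) (x' n), ∀ i, D.minStep (φ n) * c i ≤ t' n i) :
    ∃ T ∈ R.reachTimes l x, ∀ i, T i ≤ t i := by
  choose c hc hct using hmem
  choose y κ hκ hy0 harc hsafe using fun n =>
    exists_approxArc_of_mem_limitCounts hreg hD (hx' n) (hc n)
  let T : ℕ → Fin N → ℝ := fun n i => κ n i * D.ε (φ n)
  let U : Ultrafilter ℕ := hyperfilter ℕ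
  have hU : (U : Filter ℕ) ≤ atTop := Nat.hyperfilter_le_atTop
  have hr : Tendsto (fun n => 1 - 2 * (D.h (φ n) / D.ε (φ n))) atTop (𝓝 1) := by
    simpa using ((hD.ratio_tendsto.comp hφ).const_mul 2).const_sub 1
  have hti : ∀ i, Tendsto (fun n => t' n i) atTop (𝓝 (t i)) := fun i =>
    ((EuclideanSpace.proj (𝕜 := ℝ) i).continuous.tendsto t).comp ht
  -- A move lasts ε along the arc but may count as only ε − 2h on the grid; the ratio 1 − 2h/ε tends
  -- to 1.
  have hTle : ∀ n i, T n i * (1 - 2 * (D.h (φ n) / D.ε (φ n))) ≤ t' n i := by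
    intro n i
    have h1 : T n i * (1 - 2 * (D.h (φ n) / D.ε (φ n))) =
        κ n i * (D.ε (φ n) - 2 * D.h (φ n)) := by
      have := (hD.eps_pos (φ n)).ne'
      simp only [T]
      field_simp
    rw [h1]
    have h2 : (κ n i : ℝ) ≤ c n i := by exact_mod_cast hκ n i
    have h3 := hD.le_minStep (φ n)
    have h4 := hD.minStep_pos (φ n)
    refine le_trans ?_ (hct n i)
    calc (κ n i : ℝ) * (D.ε (φ n) - 2 * D.h (φ n)) ≤ κ n i * D.minStep (φ n) :=
          mul_le_mul_of_nonneg_left h3 (Nat.cast_nonneg _)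
      _ ≤ D.minStep (φ n) * c n i := by
          rw [mul_comm]; exact mul_le_mul_of_nonneg_left h2 h4.le
  have hT0 : ∀ n i, 0 ≤ T n i := fun n i =>
    mul_nonneg (Nat.cast_nonneg _) (hD.eps_pos (φ n)).le
  have hbound : ∀ᶠ n in (U : Filter ℕ), T n ∈ Icc (0 : Fin N → ℝ) fun i => 2 * (t i + 1) := by
    have e1 : ∀ᶠ n in atTop, ∀ i, t' n i < t i + 1 :=
      eventually_all.2 fun i => (hti i).eventually (gt_mem_nhds (by linarith))
    have e2 := hr.eventually (lt_mem_nhds (by norm_num : (1 : ℝ) / 2 < 1))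
    filter_upwards [hU e1, hU e2] with n h1 h2
    exact ⟨hT0 n, fun i => by nlinarith [hTle n i, h1 i, hT0 n i]⟩
  obtain ⟨T₀, -, hT₀⟩ := isCompact_Icc.exists_tendsto_ultrafilter U hbound
  refine ⟨T₀, hreg.mem_reachTimes_of_tendsto hR U (a := fun n => D.pathError R l (φ n)) (y := y)
    (T := T) (.of_forall harc) (((tendsto_pathError hD).comp hφ).mono_left hU) hT₀ ?_ ?_,
    fun i => ?_⟩
  · simp only [hy0]
    exact hx.mono_left hU
  · intro s hs
    have h1 := (hD.eps_tendsto.comp hφ).eventually (gt_mem_nhds hs)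
    exact hU (h1.mono fun n hn => hsafe n s hn.le)
  · have h1 : Tendsto (fun n => T n i * (1 - 2 * (D.h (φ n) / D.ε (φ n)))) U (𝓝 (T₀ i)) := by
      simpa using (tendsto_pi_nhds.1 hT₀ i).mul (hr.mono_left hU)
    exact le_of_tendsto_of_tendsto h1 ((hti i).mono_left hU) (.of_forall fun n => hTle n i)

/-- Componentwise choice of nearest grid points realizes the joint resolution. -/
theorem Admissible.exists_nearest (hD : D.Admissible R) (p : ℕ) (hne : R.joint.Nonempty) :
    ∃ g : (i : Fin N) → RState d → RState d, (∀ i q, g i q ∈ D.grid p i) ∧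
      ∀ q ∈ R.joint, ‖q - (WithLp.toLp 2 fun i => g i (q i))‖ ≤ D.h p := by
  have hex : ∀ i q, ∃ g ∈ D.grid p i, ∀ g' ∈ D.grid p i, ‖q - g‖ ≤ ‖q - g'‖ := by
    intro i q
    obtain ⟨x, hx⟩ := hne
    obtain ⟨x', hx', -⟩ := hD.resolution p x hx
    obtain ⟨g, hg, hmin⟩ := Set.exists_min_image (D.grid p i) (fun g => ‖q - g‖)
      (hD.grid_finite p i) ⟨_, hx' i⟩
    exact ⟨g, hg, hmin⟩
  choose g hg hmin using hex
  refine ⟨g, hg, fun q hq => ?_⟩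
  obtain ⟨x', hx', hle⟩ := hD.resolution p q hq
  refine le_trans ?_ hle
  rw [PiLp.norm_eq_of_L2, PiLp.norm_eq_of_L2]
  refine Real.sqrt_le_sqrt (Finset.sum_le_sum fun i _ => ?_)
  exact pow_le_pow_left₀ (norm_nonneg _) (hmin i (q i) (x' i) (hx' i)) 2

/-- A robot which is still under way on the grid will not arrive within the next time step. -/
theorem UnderWay.add_eps_lt (hD : D.Admissible R) {i : Fin N} {y : ℝ → RState d} {T : ℝ}
    (h : R.IsArc l i y T) {s : ℝ} (hs : 0 ≤ s) {a : RState d} (ha : ‖y s - a‖ ≤ D.h p)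
    (hu : D.UnderWay R p i a) : s + D.ε p < T := by
  by_contra! hle
  obtain ⟨-, -, hlip, -, hrest, hgoal⟩ := RobotTeam.isArc_iff.1 h
  have h1 : ‖y T - y s‖ ≤ R.M i * D.ε p := by
    rcases le_total s T with hj | hj
    · exact (hlip _ _ hs hj).trans (mul_le_mul_of_nonneg_left (by linarith) (R.M_nonneg i))
    · rw [hrest _ hj, sub_self, norm_zero]
      exact mul_nonneg (R.M_nonneg i) (hD.eps_pos p).le
  have h2 : dist a (y T) ≤ R.M i * D.ε p + D.h p := by
    rw [dist_comm, dist_eq_norm]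
    have := norm_sub_le_norm_sub_add_norm_sub (y T) (y s) a
    linarith
  refine absurd hu (not_lt.2 ((Metric.infEDist_le_edist_of_mem hgoal).trans ?_))
  rw [edist_dist]
  exact ENNReal.ofReal_le_ofReal h2

/-- Grid points close to an arc at consecutive times are joined by a grid step. -/
theorem mem_stepX_of_isArc (hreg : R.Regular l) (hD : D.Admissible R) {i : Fin N}
    {y : ℝ → RState d} {T : ℝ} (h : R.IsArc l i y T) {s : ℝ} (hs : 0 ≤ s) (hsT : s + D.ε p ≤ T)
    {a b : RState d} (haX : a ∈ R.X i) (hbX : b ∈ R.X i) (ha : ‖y s - a‖ ≤ D.h p)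
    (hb : ‖y (s + D.ε p) - b‖ ≤ D.h p) (hu : D.UnderWay R p i a) : b ∈ D.stepX R l p i a := by
  have hε := hD.eps_pos p
  have hh := hD.h_pos p
  rw [stepX, if_pos hu]
  refine ⟨hbX, ?_⟩
  obtain ⟨-, hmem, -, hst, -, -⟩ := RobotTeam.isArc_iff.1 h
  obtain ⟨v, hv, h1⟩ := hst s (s + D.ε p) hs (by linarith) hsT
  obtain ⟨w, hw, h2⟩ := hreg.F_lipschitz i _ (hmem _ hs) _ haX _ hv
  refine (Metric.infEDist_le_edist_of_mem (mem_image_of_mem _ hw)).trans ?_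
  rw [edist_dist, dist_eq_norm]
  refine ENNReal.ofReal_le_ofReal ?_
  rw [add_sub_cancel_left] at h1
  -- The three summands match the three terms of α: arc increment (ε² l⁺M⁺), change of base point
  -- from y s to a (ε h l⁺), and rounding at both ends (2h).
  have e : b - (a + D.ε p • w) = (y (s + D.ε p) - y s - D.ε p • v) + D.ε p • (v - w) +
      ((y s - a) - (y (s + D.ε p) - b)) := by
    rw [smul_sub]; abel
  rw [e]
  refine norm_add₃_le.trans ?_
  have h5 := norm_sub_le (y s - a) (y (s + D.ε p) - b)
  rw [norm_smul, Real.norm_of_nonneg hε.le]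
  have hl := hreg.l_nonneg i
  have hM := R.M_nonneg i
  have hM' := R.M_le_Mplus i
  have hl' := RobotTeam.le_sqrt_sum_sq l i
  have h6 : D.ε p * ‖v - w‖ ≤ D.ε p * D.h p * Real.sqrt (∑ i, l i ^ 2) := by
    rw [mul_assoc]
    refine mul_le_mul_of_nonneg_left (h2.trans ?_) hε.le
    rw [mul_comm]
    exact mul_le_mul ha hl' hl hh.le
  have h7 : l i * R.M i * D.ε p ^ 2 ≤ D.ε p ^ 2 * Real.sqrt (∑ i, l i ^ 2) * R.Mplus := by
    rw [mul_assoc (D.ε p ^ 2), mul_comm]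
    exact mul_le_mul_of_nonneg_left (mul_le_mul hl' hM' hM (hl.trans hl')) (sq_nonneg _)
  unfold α
  linarith

/-- Arcs are shadowed by grid paths. -/
theorem exists_mem_limitCounts_of_isTeamArc (hreg : R.Regular l) (hD : D.Admissible R) {ρ : ℝ}
    (hρ : ∀ i j, i ≠ j → ∀ x ∈ R.XG i, ∀ y ∈ R.XF j, R.σ + ρ < ‖x - y‖)
    (hp : ∀ i, R.M i * D.ε p + 2 * D.h p < ρ) {x : JState N d} {y : ℝ → JState N d}
    {T : Fin N → ℝ} (h : R.IsTeamArc l x y T) :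
    ∃ x' ∈ D.jointGrid p, ‖x' - x‖ ≤ D.h p ∧ ∃ c ∈ D.limitCounts R l p x',
      ∀ i, D.minStep p * c i ≤ T i := by
  classical
  have hε := hD.eps_pos p
  have hh := hD.h_pos p
  have hjoint : ∀ s, 0 ≤ s → y s ∈ R.joint := fun s hs => R.safe_subset_joint (h.safe s hs)
  obtain ⟨near, hnear, hnear'⟩ := hD.exists_nearest p ⟨_, hjoint 0 le_rfl⟩
  have htime : ∀ j : ℕ, 0 ≤ j * D.ε p := fun j => by positivity
  let g : ℕ → Fin N → RState d := fun j i => near i (y (j * D.ε p) i)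
  have hgX : ∀ j i, g j i ∈ R.X i := fun j i => hD.grid_subset p i (hnear _ _)
  have hgy : ∀ (j : ℕ) (i : Fin N), ‖y (j * D.ε p) i - g j i‖ ≤ D.h p := fun j i =>
    (PiLp.norm_apply_le (y (j * D.ε p) - WithLp.toLp 2 fun i => g j i) i).trans
      (hnear' _ (hjoint _ (htime j)))
  have hbefore : ∀ (i : Fin N) (j : ℕ), D.UnderWay R p i (g j i) → j * D.ε p + D.ε p < T i := fun i j hu =>
    UnderWay.add_eps_lt hD (h.arc i) (htime j) (hgy j i) hu
  have hex : ∀ i, ∃ j, ¬ D.UnderWay R p i (g j i) := by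
    intro i
    obtain ⟨j, hj⟩ := exists_nat_gt (T i / D.ε p)
    rw [div_lt_iff₀ hε] at hj
    exact ⟨j, fun hu => by linarith [hbefore i j hu]⟩
  let κ : Fin N → ℕ := fun i => Nat.find (hex i)
  have hκ : ∀ i, ¬ D.UnderWay R p i (g (κ i) i) := fun i => Nat.find_spec (hex i)
  have hκ' : ∀ i j, j < κ i → D.UnderWay R p i (g j i) := fun i j hj =>
    not_not.1 (Nat.find_min (hex i) hj)
  let z : ℕ → JState N d := fun j => WithLp.toLp 2 fun i => g (min j (κ i)) i
  have hz : ∀ j i, z j i = g (min j (κ i)) i := fun j i => rfl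
  -- The unrounded counterpart of z, with robot i stopped at step κ i, possibly before it reaches
  -- its goal. It witnesses that z is near the safety region.
  let q : ℕ → JState N d := fun j => WithLp.toLp 2 fun i => y ((min j (κ i) : ℕ) * D.ε p) i
  have hq : ∀ j i, q j i = y ((min j (κ i) : ℕ) * D.ε p) i := fun j i => rfl
  have hqF : ∀ j i, q j i ∈ R.XF i := fun j i => (h.safe _ (htime _)).1 i
  -- A stopped robot is less than ρ − h from a goal point on the grid, hence less than ρ along the
  -- arc. That goal point is more than σ + ρ away from every other robot.
  have hstopped : ∀ J i j, i ≠ j → κ i ≤ J → R.σ ≤ ‖q J i - q J j‖ := by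
    intro J i j hij hJ
    obtain ⟨a, ha, hlt⟩ := exists_goal_of_not_underWay hD (hκ i) (r := ρ - D.h p)
      (by linarith [hp i])
    have h1 := hρ i j hij a ha _ (hqF J j)
    have h2 : q J i = y (κ i * D.ε p) i := by rw [hq, min_eq_right hJ]
    have h3 := hgy (κ i) i
    have h4 := norm_sub_le_norm_sub_add_norm_sub a (q J i) (q J j)
    have h5 := norm_sub_le_norm_sub_add_norm_sub a (g (κ i) i) (q J i)
    rw [h2] at h4 h5 ⊢
    rw [norm_sub_rev a (g _ _), norm_sub_rev (g _ _) (y _ i)] at h5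
    linarith
  have hqsafe : ∀ J, q J ∈ R.safe := by
    intro J
    refine ⟨hqF J, fun i j hij => ?_⟩
    rcases le_total (κ i) J with hi | hi
    · exact hstopped J i j hij hi
    · rcases le_total (κ j) J with hj | hj
      · rw [norm_sub_rev]
        exact hstopped J j i hij.symm hj
      · rw [hq J i, hq J j, min_eq_left hi, min_eq_left hj]
        exact (h.safe _ (htime J)).2 i j hij
  have hzgrid : ∀ j, z j ∈ D.jointGrid p := fun j i => hnear _ _
  have hzsafe : ∀ j, z j ∈ D.safeGrid R p := by
    intro j
    refine ⟨hzgrid j, (Metric.infEDist_le_edist_of_mem (hqsafe j)).trans ?_⟩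
    rw [edist_comm, edist_dist, dist_eq_norm]
    exact ENNReal.ofReal_le_ofReal (hnear' _ (R.safe_subset_joint (hqsafe j)))
  have hstep : ∀ j i, z (j + 1) i ∈ D.stepX R l p i (z j i) := by
    intro j i
    rw [hz, hz]
    rcases le_or_gt (κ i) j with hj | hj
    · rw [min_eq_right hj, min_eq_right (hj.trans (Nat.le_succ j)),
        stepX_of_not_underWay (hκ i)]
      rfl
    · have hu := hκ' i j hj
      have hcast : ((j + 1 : ℕ) : ℝ) * D.ε p = j * D.ε p + D.ε p := by push_cast; ring
      have h4 := hgy (j + 1) i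
      rw [hcast] at h4
      rw [min_eq_left hj.le, min_eq_left (Nat.succ_le_of_lt hj)]
      exact mem_stepX_of_isArc hreg hD (h.arc i) (htime j) (hbefore i j hu).le (hgX _ _) (hgX _ _)
        (hgy j i) h4 hu
  have hz0 : ‖z 0 - x‖ ≤ D.h p := by
    have h1 := hnear' _ (hjoint 0 le_rfl)
    have h2 : z 0 = WithLp.toLp 2 fun i => near i (y 0 i) := by
      ext1 i
      simp [hz, g]
    rw [h2, norm_sub_rev, ← h.start]
    exact h1
  -- The budget κ i − j counts the remaining moves; truncated subtraction makes it 0 once the robot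
  -- rests.
  refine ⟨z 0, hzgrid 0, hz0, κ, (mem_limitCounts_iff hD).2 ⟨z, fun j i => κ i - j, rfl,
    by simp, fun j => ⟨hzsafe (j + 1), hstep j⟩, fun j i => ?_⟩, fun i => ?_⟩
  · unfold moving
    dsimp only
    rcases le_or_gt (κ i) j with hj | hj
    · rw [if_neg (by rw [hz, min_eq_right hj]; exact hκ i)]
      omega
    · split_ifs <;> omega
  · have h1 : D.minStep p * κ i ≤ κ i * D.ε p := by
      rw [mul_comm]
      exact mul_le_mul_of_nonneg_left (hD.minStep_le p) (Nat.cast_nonneg _)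
    refine h1.trans ?_
    rcases Nat.eq_zero_or_pos (κ i) with h0 | h0
    · rw [h0, Nat.cast_zero, zero_mul]
      exact (h.arc i).nonneg
    · obtain ⟨k, hk⟩ := Nat.exists_eq_add_of_le' h0
      have h2 := hbefore i k (hκ' i k (by omega))
      rw [hk]
      push_cast
      linarith

end Discretization

/-! ### The case of no robots and the main theorem -/

theorem minArrival_nonempty_of_isEmpty {d : ℕ} (R : RobotTeam 0 d) (x : JState 0 d) :
    (R.minArrival x).Nonempty := by
  let π : (i : Fin 0) → JState 0 d → EuclideanSpace ℝ (Fin (R.m i)) := fun i => i.elim0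
  have hπ : R.IsPolicy π := fun i => i.elim0
  have hne : ∃ t, t ∈ R.arrivalTimes π x := by
    by_cases h : ∃ y t', R.IsExecution π x y t'
    · obtain ⟨y, t', h⟩ := h
      exact ⟨t', .inl ⟨y, h⟩⟩
    · exact ⟨⊤, .inr ⟨h, rfl⟩⟩
  obtain ⟨t, ht⟩ := hne
  exact ⟨t, ⟨π, hπ, ht⟩, fun ⟨t', _, hne, _⟩ => hne (Subsingleton.elim _ _)⟩

theorem mainTheorem7 {N d : ℕ} (R : RobotTeam N d) (l : Fin N → ℝ) (D : Discretization N d)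
    (hR : R.WellPosed) (hreg : R.Regular l) (hclear : R.GoalsClear) (hD : D.Admissible R) :
    (∀ p, ∃ Θ : JState N d → Set (TimeVec N), D.IsValueLimit R l p Θ) ∧
    ∀ Θinf : ℕ → JState N d → Set (TimeVec N), (∀ p, D.IsValueLimit R l p (Θinf p)) →
      ∀ η : ℕ → ℝ, (∀ p, D.h p ≤ η p) → Tendsto η atTop (𝓝 0) →
        ∀ x ∈ R.joint,
          IsKuratowskiLimit
            (fun p => ⋃ x' ∈ {x' : JState N d | x' ∈ D.jointGrid p ∧ ‖x' - x‖ ≤ η p},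
              epiProfile (Θinf p) x')
            (epiProfile R.minArrival x) := by
  refine ⟨fun p => ⟨_, Discretization.isValueLimit_latticeFrontier hD⟩, ?_⟩
  intro Θinf hΘ η hη hη0 x hx
  rcases Nat.eq_zero_or_pos N with rfl | hN
  · rw [epiProfile_eq_univ (minArrival_nonempty_of_isEmpty R x)]
    refine .of_subset (fun t _ => mem_kuratowskiLiminf_of_eventually_mem
      (.of_forall fun p => ?_)) (subset_univ _)
    obtain ⟨x', hx', hle⟩ := hD.resolution p x hx
    rw [norm_sub_rev] at hle
    refine mem_biUnion (x := x') ⟨hx', hle.trans (hη p)⟩ ?_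
    rw [(hΘ p).epiProfile_eq hD hx',
      epiProfile_eq_univ (latticeFrontier_nonempty (hD.minStep_pos p) _)]
    exact mem_univ t
  · refine .of_subset (fun t ht => mem_kuratowskiLiminf_of_eventually_mem ?_) fun t ht => ?_
    · obtain ⟨T, ⟨y, hy⟩, hle⟩ := (hreg.mem_epiProfile_minArrival hR hN x t).1 ht
      obtain ⟨ρ, hρ, hclear⟩ := hclear
      have hev : ∀ᶠ p in atTop, ∀ i, R.M i * D.ε p + 2 * D.h p < ρ := by
        refine eventually_all.2 fun i => ?_
        have h1 : Tendsto (fun p => R.M i * D.ε p + 2 * D.h p) atTop (𝓝 0) := by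
          simpa using (hD.eps_tendsto.const_mul (R.M i)).add (hD.h_tendsto.const_mul 2)
        exact h1.eventually (gt_mem_nhds hρ)
      filter_upwards [hev] with p hp
      obtain ⟨x', hx', hxx, c, hc, hcT⟩ :=
        Discretization.exists_mem_limitCounts_of_isTeamArc hreg hD hclear hp hy
      exact mem_biUnion (x := x') ⟨hx', hxx.trans (hη p)⟩
        (((hΘ p).mem_epiProfile_iff hD hN hx' t).2 ⟨c, hc, fun i => (hcT i).trans (hle i)⟩)
    · rw [hreg.mem_epiProfile_minArrival hR hN x t]
      -- Membership in the upper limit gives points of the grid profiles only for infinitely many p;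
      -- a subsequence with distances below 1/(n + 1) is extracted.
      obtain ⟨φ, hφ, hφ'⟩ := extraction_forall_of_frequently fun n : ℕ =>
        frequently_inter_nonempty_of_mem_kuratowskiLimsup ht
          (Metric.ball_mem_nhds t (Nat.one_div_pos_of_nat (α := ℝ) (n := n)))
      choose t' ht' htt using hφ'
      simp only [mem_iUnion] at ht'
      choose x' hx' ht'' using ht'
      refine Discretization.exists_reachTimes_of_limit hreg hR hD hφ.tendsto_atTop
        (fun n => (hx' n).1) ?_ ?_
        fun n => ((hΘ (φ n)).mem_epiProfile_iff hD hN (hx' n).1 _).1 (ht'' n)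
      · rw [tendsto_iff_norm_sub_tendsto_zero]
        exact squeeze_zero (fun n => norm_nonneg _) (fun n => (hx' n).2)
          (hη0.comp hφ.tendsto_atTop)
      · rw [tendsto_iff_dist_tendsto_zero]
        exact squeeze_zero (fun n => dist_nonneg) (fun n => (Metric.mem_ball.1 (htt n)).le)
          tendsto_one_div_add_atTop_nhds_zero_nat
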